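/- Let $q\ge 1$ and $b_1,\dots,b_q\in\mathbb{C}$. Assume that $b_1,\dots,b_q$ are numbered so that their congruence classes mod $\mathbb{Z}$ (as a multiset) are consecutive blocks, of sizes $n_1,\dots,n_r\ge 1$ with $n_1+\dots+n_r=q$, and that within each block the real parts are non-increasing. For $1\le j\le q$, let $i+1,\dots,i+k$ be the indices of the block that contains $j$ and write $j=i+\ell$, $1\le \ell\le k$; put $S_j=\{i+1,\dots,i+\ell\}$. Define Meijer's function on the Riemann surface of the logarithm by $$G_j(z)=G^{\ell,0}_{0,q}\bigl(b_{i+1},\dots,b_{i+\ell};\,\text{the remaining } b\text{'s}\,\big|\,z\bigr)=-\sum_{\omega_0}\operatorname*{Res}_{\omega=\omega_0}\ \frac{\prod_{s\in S_j}\Gamma(b_s-\omega)}{\prod_{s\notin S_j}\Gamma(1-b_s+\omega)}\,z^{\omega},$$ where $\omega_0$ runs through the set $\bigcup_{s\in S_j}(b_s+\mathbb{N}_0)$ and $z^\omega=e^{\omega\log z}$; i.e. the Mellin--Barnes integral over a contour encircling these poles once in negative orientation. Poles of higher order are allowed. Then the following hold. (i) For all $j$ and all values of $\log z$ the sum of residues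 converges absolutely. (ii) Let $U\subseteq\mathbb{C}\setminus\{0\}$ be open and connected (and non-empty), and suppose that for each $j$ a continuous branch of $\log((-1)^{\ell}\zeta)$ on $U$ is chosen, with $\ell=\ell(j)$ the position of $j$ in its block. Then the functions $$y_j(\zeta)=G_j\bigl((-1)^{\ell}\zeta\bigr),\qquad 1\le j\le q,$$ form a fundamental system of solutions on $U$ of the $q$th-order equation $$\Bigl[\prod_{j=1}^q\Bigl(\zeta\frac{d}{d\zeta}-b_j\Bigr)-\zeta\Bigr]u(\zeta)=0,$$ that is, they are holomorphic solutions on $U$, they are linearly independent over $\mathbb{C}$, and every holomorphic solution on $U$ is a linear combination of them. (iii) If $j$ is the first index of its block ($\ell=1$), then for $\zeta\in U$, with the same branch, $$y_j(\zeta)=\frac{(-\zeta)^{b_j}}{\prod_{j'=1}^q\Gamma(1+b_j-b_{j'})}\;{}_0F_{q-1}\bigl(;\,(1+b_j-b_{j'})_{j'\ne j}\,\big|\,\zeta\bigr),$$ where ${}_0F_{q-1}(;\beta_1,\dots,\beta_{q-1}\,|\,\zeta)=\sum_{k\ge0}\zeta^k/\bigl(k!\,\prod_{m}(\beta_m)_k\bigr)$.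 (iv) Let $d_j=\#\{s\in S_j: b_s=b_j\}$. There is a constant $C_j\neq0$ such that, for every $A>0$, $$\frac{G_j(z)}{z^{b_j}(\log z)^{d_j-1}}\longrightarrow C_j\quad\text{as } |z|\to0 \text{ with } |\arg z|\le A .$$ In particular, logarithms occur in the leading small-$\zeta$ behaviour of $y_j$ whenever $b_j$ is repeated among $b_{i+1},\dots,b_{i+\ell}$. -/

import Mathlib

open Filter Topology

noncomputable section

namespace MeijerEuler

/-- The residue of `f` at an isolated singularity `a`: the value `(2πi)⁻¹ ∮ f` over all
sufficiently small positively oriented circles around `a`. -/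
def residue (f : ℂ → ℂ) (a : ℂ) : ℂ :=
  limUnder (𝓝[>] (0 : ℝ))
    (fun r : ℝ => (2 * Real.pi * Complex.I)⁻¹ * ∮ w in C(a, r), f w)

/-- The Mellin--Barnes integrand of `G^{m,0}_{0,q}`. The parameters `b i` with `i ∈ S` are those to
the left of the semicolon (so `m = S.card`), the others are those to its right. The argument `z` of
the `G`-function is given by one of its logarithms `t`, so that `z ^ ω = exp (ω * t)`; this makes
the `G`-function a function on the Riemann surface of the logarithm. -/
def meijerIntegrand {q : ℕ} (b : Fin q → ℂ) (S : Finset (Fin q)) (t ω : ℂ) : ℂ :=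
  (∏ i ∈ S, Complex.Gamma (b i - ω)) / (∏ i ∈ Sᶜ, Complex.Gamma (1 - b i + ω)) *
    Complex.exp (ω * t)

/-- The poles of the functions `ω ↦ Γ(b i - ω)`, `i ∈ S`. -/
def meijerPoles {q : ℕ} (b : Fin q → ℂ) (S : Finset (Fin q)) : Set ℂ :=
  {ω | ∃ i ∈ S, ∃ n : ℕ, ω = b i + n}

/-- Meijer's function `G^{m,0}_{0,q}(b i, i ∈ S; b i, i ∉ S | z)` at `z = exp t`: the Mellin--Barnes
integral over a contour that encircles the poles once in negative orientation, that is, minus the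
sum of the residues of the integrand. -/
def meijerG {q : ℕ} (b : Fin q → ℂ) (S : Finset (Fin q)) (t : ℂ) : ℂ :=
  -∑' ω : meijerPoles b S, residue (meijerIntegrand b S t) ω

/-- The generalized hypergeometric function `₀F_s` with lower parameters `β`. -/
def hypergeometricZeroF {κ : Type*} [Fintype κ] (β : κ → ℂ) (ζ : ℂ) : ℂ :=
  ∑' k : ℕ, ζ ^ k / ((∏ i, (ascPochhammer ℂ k).eval (β i)) * (k.factorial : ℂ))

/-- The first-order operator `ζ d/dζ - c`. -/
def eulerFactor (c : ℂ) (u : ℂ → ℂ) : ℂ → ℂ :=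
  fun ζ => ζ * deriv u ζ - c * u ζ

/-- The operator `∏ j, (ζ d/dζ - b j)`. -/
def eulerProd {q : ℕ} (b : Fin q → ℂ) (u : ℂ → ℂ) : ℂ → ℂ :=
  (List.ofFn b).foldr eulerFactor u

/-- `u` is a (holomorphic) solution of `[∏ j, (ζ d/dζ - b j) - ζ] u = 0` on the open set `U`. -/
def IsSolution {q : ℕ} (b : Fin q → ℂ) (U : Set ℂ) (u : ℂ → ℂ) : Prop :=
  DifferentiableOn ℂ u U ∧ ∀ ζ ∈ U, eulerProd b u ζ - ζ * u ζ = 0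

/-- `y 0, …, y (q - 1)` is a fundamental system on `U`, that is, a basis of the solution space. -/
def IsFundamentalSystem {q : ℕ} (b : Fin q → ℂ) (U : Set ℂ) (y : Fin q → ℂ → ℂ) : Prop :=
  (∀ j, IsSolution b U (y j)) ∧
  LinearIndependent ℂ (fun j => fun ζ : U => y j ζ) ∧
  ∀ u, IsSolution b U u → ∃ a : Fin q → ℂ, ∀ ζ ∈ U, u ζ = ∑ j, a j * y j ζ

/-- The position `ℓ = 1, …, n_s` of the index `j` within its block of the composition
`q = n_1 + ⋯ + n_r`. -/
def pos {q : ℕ} (c : Composition q) (j : Fin q) : ℕ :=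
  (c.invEmbedding j : ℕ) + 1

/-- The indices of the block of `j` up to and including `j`. -/
def upTo {q : ℕ} (c : Composition q) (j : Fin q) : Finset (Fin q) :=
  Finset.univ.filter (fun i => c.index i = c.index j ∧ i ≤ j)

/-- The number of the parameters `b i`, `i` in the block of `j` and `i ≤ j`, that are equal
to `b j`. -/
def mult {q : ℕ} (c : Composition q) (b : Fin q → ℂ) (j : Fin q) : ℕ :=
  Nat.card {i // i ∈ upTo c j ∧ b i = b j}

end MeijerEuler

end

/-! ### Frobenius series in contour form -/

noncomputable section

namespace MeijerEuler

/-! Fix `j` and put `β = b j`. The ordering of the real parts gives `b s = β + n s` with `n s ∈ ℕ`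
for all `s` in `S = upTo c j`, so the poles are exactly `β + ℕ`. Near the pole, with `ω = β + m +
w`, the reflection formula replaces each `Γ(b s - ω)` by `± π / sin (π w)` times `1 / Γ(1 - b s +
ω)` (`meijerIntegrand_eq`). Hence, up to a constant sign, the integrand is `(π / sin (π w)) ^ ℓ *
(-1) ^ (m ℓ) * E(ω) * exp (ω t)`, where `E = recipGammaProd b` is entire and `ℓ = |S|`. Each residue
is an integral over the fixed circle `|w| = 1/2`, so poles of any order are treated alike and no
residue has to be expanded.

Everything then follows from `∏ s, (ω + 1 - b s) * E(ω + 1) = E(ω)`. It forces superexponential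
decay in `m`, hence absolute convergence and termwise differentiation
(`rapidlyDecaying_recipGammaProd`). Since `ζ d/dζ = d/dt` multiplies coefficients by `ω`, it also
shows that the differential operator shifts the series by one index. The `m = 0` term left over is
zero, because the zero of `E` at `β - 1` cancels the pole of order `ℓ`
(`frobeniusTerm_zero_eq_zero`).

As `Re t → -∞` in a strip the term `m = 0` dominates. Its pole has order `ℓ` minus the order of the
zero of `E` at `β`, which is `d_j`; this gives the leading term `C * exp (β t) * t ^ (d_j - 1)`
(`tendsto_meijerG`). For `ℓ = 1` all poles are simple and Cauchy's formula yields the hypergeometric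
series (`meijerG_singleton`).

A linear relation on `U` extends to the whole `t`-plane and may be shifted by `2πik`. The data `(Re
b j, d_j, exp (2πi b j))` determine `j`, so comparing leading terms of the shifted relations gives
independence (`eq_zero_of_leading_terms`). Solutions are determined by `q` derivatives at one point
(`IsSolution.eq_zero`), so `q` independent solutions span. -/

/-- The `m`-th term `(2πi)⁻¹ ∮ c m w * exp ((β + m + w) t) dw` of a Frobenius series in contour form;
the contour is the circle of radius `1 / 2` around the origin. -/
def frobeniusTerm (β : ℂ) (c : ℕ → ℂ → ℂ) (m : ℕ) (t : ℂ) : ℂ :=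
  (2 * Real.pi * Complex.I)⁻¹ * ∮ w in C(0, 1 / 2), c m w * Complex.exp ((β + m + w) * t)

/-- The Frobenius series with coefficient functions `c`. -/
def frobeniusSeries (β : ℂ) (c : ℕ → ℂ → ℂ) (t : ℂ) : ℂ :=
  ∑' m, frobeniusTerm β c m t

/-- `c m` is continuous on the contour and decays there faster than every geometric sequence. -/
def RapidlyDecaying (c : ℕ → ℂ → ℂ) : Prop :=
  (∀ m, ContinuousOn (c m) (Metric.sphere 0 (1 / 2))) ∧
  ∃ M : ℕ → ℝ, (∀ m, ∀ w ∈ Metric.sphere (0 : ℂ) (1 / 2), ‖c m w‖ ≤ M m) ∧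
    ∀ R : ℝ, 0 ≤ R → Summable fun m => M m * R ^ m

lemma half_mem_sphere : (1 / 2 : ℂ) ∈ Metric.sphere (0 : ℂ) (1 / 2) := by simp

lemma circleMap_mem_sphere_half (θ : ℝ) :
    circleMap 0 (1 / 2) θ ∈ Metric.sphere (0 : ℂ) (1 / 2) :=
  circleMap_mem_sphere 0 (by norm_num) θ

lemma norm_exp_mul_le {w : ℂ} (hw : w ∈ Metric.sphere (0 : ℂ) (1 / 2)) (β t : ℂ) (m : ℕ) :
    ‖Complex.exp ((β + m + w) * t)‖ ≤
      ‖Complex.exp (β * t)‖ * Real.exp (m * t.re) * Real.exp (‖t‖ / 2) := by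
  have e : (β + m + w) * t = β * t + m * t + w * t := by ring
  rw [e, Complex.exp_add, Complex.exp_add, norm_mul, norm_mul]
  have h1 : ‖Complex.exp (m * t)‖ = Real.exp (m * t.re) := by
    rw [Complex.norm_exp]; simp
  rw [h1]
  gcongr
  rw [Complex.norm_exp]
  gcongr
  calc (w * t).re ≤ ‖w * t‖ := Complex.re_le_norm _
    _ = ‖t‖ / 2 := by
      have : ‖w‖ = 1 / 2 := by simpa using hw
      rw [norm_mul, this]; ring

lemma norm_frobeniusTerm_le (β : ℂ) {c : ℕ → ℂ → ℂ} {m : ℕ} {K : ℝ}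
    (hK : ∀ w ∈ Metric.sphere (0 : ℂ) (1 / 2), ‖c m w‖ ≤ K) (t : ℂ) :
    ‖frobeniusTerm β c m t‖ ≤
      K * (‖Complex.exp (β * t)‖ * Real.exp (m * t.re) * Real.exp (‖t‖ / 2)) := by
  have hK0 : 0 ≤ K := (norm_nonneg _).trans (hK _ half_mem_sphere)
  refine (circleIntegral.norm_two_pi_i_inv_smul_integral_le_of_norm_le_const
    (f := fun w => c m w * Complex.exp ((β + m + w) * t)) (c := 0) (R := 1 / 2)
    (C := K * (‖Complex.exp (β * t)‖ * Real.exp (m * t.re) * Real.exp (‖t‖ / 2)))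
    (by norm_num) ?_).trans ?_
  · intro w hw
    rw [norm_mul]
    exact mul_le_mul (hK w hw) (norm_exp_mul_le hw β t m) (norm_nonneg _) hK0
  · have : 0 ≤ K * (‖Complex.exp (β * t)‖ * Real.exp (m * t.re) * Real.exp (‖t‖ / 2)) := by
      positivity
    linarith

/-- A majorant uniform in `‖t‖ ≤ R`, as needed for the Weierstrass test and for termwise
differentiation. -/
lemma norm_frobeniusTerm_le_geometric (β : ℂ) {c : ℕ → ℂ → ℂ} {m : ℕ} {K : ℝ}
    (hK : ∀ w ∈ Metric.sphere (0 : ℂ) (1 / 2), ‖c m w‖ ≤ K) {t : ℂ} {R : ℝ} (ht : ‖t‖ ≤ R) :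
    ‖frobeniusTerm β c m t‖ ≤
      K * Real.exp R ^ m * (Real.exp (‖β‖ * R) * Real.exp (R / 2)) := by
  have hK0 : 0 ≤ K := (norm_nonneg _).trans (hK _ half_mem_sphere)
  refine (norm_frobeniusTerm_le β hK t).trans ?_
  have h1 : ‖Complex.exp (β * t)‖ ≤ Real.exp (‖β‖ * R) := by
    rw [Complex.norm_exp]
    gcongr
    calc (β * t).re ≤ ‖β * t‖ := Complex.re_le_norm _
      _ = ‖β‖ * ‖t‖ := norm_mul _ _
      _ ≤ _ := by gcongr
  have h2 : Real.exp (m * t.re) ≤ Real.exp R ^ m := by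
    rw [← Real.exp_nat_mul]
    gcongr
    exact (Complex.re_le_norm _).trans ht
  have h3 : Real.exp (‖t‖ / 2) ≤ Real.exp (R / 2) := by gcongr
  calc _ ≤ K * (Real.exp (‖β‖ * R) * Real.exp R ^ m * Real.exp (R / 2)) := by gcongr
    _ = _ := by ring

lemma RapidlyDecaying.summable_norm {c : ℕ → ℂ → ℂ} (hc : RapidlyDecaying c) (β t : ℂ) :
    Summable fun m => ‖frobeniusTerm β c m t‖ := by
  obtain ⟨-, M, hM, hs⟩ := hc
  refine Summable.of_nonneg_of_le (fun _ => norm_nonneg _)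
    (fun m => norm_frobeniusTerm_le_geometric β (hM m) le_rfl) ?_
  exact (hs _ (Real.exp_pos _).le).mul_right _

lemma RapidlyDecaying.mul {c : ℕ → ℂ → ℂ} (hc : RapidlyDecaying c) {h : ℂ → ℂ}
    (hh : ContinuousOn h (Metric.sphere 0 (1 / 2))) :
    RapidlyDecaying fun m w => h w * c m w := by
  obtain ⟨hcont, M, hM, hs⟩ := hc
  obtain ⟨H, hH⟩ := (isCompact_sphere (0 : ℂ) (1 / 2)).exists_bound_of_continuousOn hh
  refine ⟨fun m => hh.mul (hcont m), fun m => H * M m, fun m w hw => ?_, fun R hR => ?_⟩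
  · rw [norm_mul]
    exact mul_le_mul (hH w hw) (hM m w hw) (norm_nonneg _) ((norm_nonneg _).trans (hH w hw))
  · simpa [mul_assoc] using (hs R hR).mul_left H

/-- The factor grows linearly in `m`, hence at most like `2 ^ m`; it is absorbed by using the decay
at `2 * R` instead of `R`. -/
lemma RapidlyDecaying.linear_mul {c : ℕ → ℂ → ℂ} (hc : RapidlyDecaying c) (γ : ℂ) :
    RapidlyDecaying fun m w => (γ + m + w) * c m w := by
  obtain ⟨hcont, M, hM, hs⟩ := hc
  have hM0 : ∀ m, 0 ≤ M m := fun m => (norm_nonneg _).trans (hM m _ half_mem_sphere)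
  refine ⟨fun m => ContinuousOn.mul (by fun_prop) (hcont m),
    fun m => (‖γ‖ + 2) * 2 ^ m * M m, fun m w hw => ?_, fun R hR => ?_⟩
  · rw [norm_mul]
    refine mul_le_mul_of_nonneg ?_ (hM m w hw) (norm_nonneg _) (hM0 m)
    have hw' : ‖w‖ = 1 / 2 := by simpa using hw
    have h1 : ‖γ + m + w‖ ≤ ‖γ‖ + m + 1 / 2 := by
      refine (norm_add₃_le).trans ?_
      rw [hw']; simp
    have h2 : (m : ℝ) ≤ 2 ^ m := by exact_mod_cast Nat.lt_two_pow_self.le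
    have h3 : (1 : ℝ) ≤ 2 ^ m := one_le_pow₀ (by norm_num)
    nlinarith [norm_nonneg γ]
  · have := (hs (2 * R) (by positivity)).mul_left (‖γ‖ + 2)
    refine this.congr fun m => ?_
    rw [mul_pow]; ring

lemma RapidlyDecaying.list_prod_mul {c : ℕ → ℂ → ℂ} (hc : RapidlyDecaying c) (β : ℂ)
    (l : List ℂ) :
    RapidlyDecaying fun m w => (l.map fun a => β + m + w - a).prod * c m w := by
  induction l with
  | nil => simpa using hc
  | cons a l ih =>
    convert ih.linear_mul (β - a) using 3 with m w
    simp only [List.map_cons, List.prod_cons]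
    ring

lemma hasDerivAt_frobeniusTerm (β : ℂ) {c : ℕ → ℂ → ℂ} {m : ℕ}
    (hc : ContinuousOn (c m) (Metric.sphere 0 (1 / 2))) (t : ℂ) :
    HasDerivAt (frobeniusTerm β c m)
      (frobeniusTerm β (fun m w => (β + m + w) * c m w) m t) t := by
  have hcm : Continuous fun θ : ℝ => c m (circleMap 0 (1 / 2) θ) :=
    hc.comp_continuous (continuous_circleMap 0 (1 / 2)) circleMap_mem_sphere_half
  have hcirc := continuous_circleMap 0 (1 / 2)
  have hF : ∀ x : ℂ, Continuous fun θ : ℝ => deriv (circleMap 0 (1 / 2)) θ •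
      (c m (circleMap 0 (1 / 2) θ) * Complex.exp ((β + m + circleMap 0 (1 / 2) θ) * x)) := by
    intro x
    simp only [deriv_circleMap, smul_eq_mul]
    exact (hcirc.mul continuous_const).mul (hcm.mul (by fun_prop))
  have hF' : Continuous fun p : ℂ × ℝ => deriv (circleMap 0 (1 / 2)) p.2 •
      ((β + m + circleMap 0 (1 / 2) p.2) * c m (circleMap 0 (1 / 2) p.2) *
        Complex.exp ((β + m + circleMap 0 (1 / 2) p.2) * p.1)) := by
    simp only [deriv_circleMap, smul_eq_mul]
    have h1 : Continuous fun p : ℂ × ℝ => c m (circleMap 0 (1 / 2) p.2) := hcm.comp continuous_snd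
    have h2 : Continuous fun p : ℂ × ℝ => circleMap 0 (1 / 2) p.2 := hcirc.comp continuous_snd
    exact (h2.mul continuous_const).mul
      (((continuous_const.add h2).mul h1).mul (by fun_prop))
  obtain ⟨K, hK⟩ := ((isCompact_closedBall t 1).prod
    (isCompact_uIcc (a := (0 : ℝ)) (b := 2 * Real.pi))).exists_bound_of_continuousOn
      hF'.continuousOn
  refine HasDerivAt.const_mul _ ?_
  refine (intervalIntegral.hasDerivAt_integral_of_dominated_loc_of_deriv_le
    (s := Metric.closedBall t 1) (bound := fun _ => K)
    (F' := fun x θ => deriv (circleMap 0 (1 / 2)) θ •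
      ((β + m + circleMap 0 (1 / 2) θ) * c m (circleMap 0 (1 / 2) θ) *
        Complex.exp ((β + m + circleMap 0 (1 / 2) θ) * x)))
    (Metric.closedBall_mem_nhds t one_pos) ?_ ?_ ?_ ?_ ?_ ?_).2
  · exact Eventually.of_forall fun x => (hF x).aestronglyMeasurable
  · exact (hF t).intervalIntegrable _ _
  · exact (hF'.comp (by fun_prop : Continuous fun θ : ℝ => (t, θ))).aestronglyMeasurable
  · exact Eventually.of_forall fun θ hθ x hx => hK (x, θ) ⟨hx, Set.uIoc_subset_uIcc hθ⟩
  · exact intervalIntegrable_const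
  · refine Eventually.of_forall fun θ _ x _ => ?_
    refine HasDerivAt.fun_const_smul _ ?_
    have := (((hasDerivAt_id x).const_mul (β + m + circleMap 0 (1 / 2) θ)).cexp).const_mul
      (c m (circleMap 0 (1 / 2) θ))
    refine this.congr_deriv ?_
    simp only [id, mul_one]
    ring

lemma RapidlyDecaying.hasDerivAt {c : ℕ → ℂ → ℂ} (hc : RapidlyDecaying c) (β t : ℂ) :
    HasDerivAt (frobeniusSeries β c)
      (frobeniusSeries β (fun m w => (β + m + w) * c m w) t) t := by
  obtain ⟨-, M, hM, hs⟩ := hc.linear_mul β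
  have ht : t ∈ Metric.ball (0 : ℂ) (‖t‖ + 1) := by simp
  refine hasDerivAt_tsum_of_isPreconnected (t := Metric.ball 0 (‖t‖ + 1)) (y₀ := t)
    ((hs _ (Real.exp_pos (‖t‖ + 1)).le).mul_right _)
    Metric.isOpen_ball (convex_ball _ _).isPreconnected
    (fun m y _ => hasDerivAt_frobeniusTerm β (hc.1 m) y)
    (fun m y hy => norm_frobeniusTerm_le_geometric β (hM m) (by simpa using (Metric.mem_ball.1 hy).le))
    ht (hc.summable_norm β t).of_norm ht

lemma frobeniusTerm_sub (β : ℂ) {c d : ℕ → ℂ → ℂ} {m : ℕ}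
    (hc : ContinuousOn (c m) (Metric.sphere 0 (1 / 2)))
    (hd : ContinuousOn (d m) (Metric.sphere 0 (1 / 2))) (t : ℂ) :
    frobeniusTerm β (fun m w => c m w - d m w) m t =
      frobeniusTerm β c m t - frobeniusTerm β d m t := by
  simp only [frobeniusTerm, sub_mul]
  rw [circleIntegral.integral_sub, mul_sub]
  · exact ContinuousOn.circleIntegrable (by norm_num) (hc.mul (by fun_prop))
  · exact ContinuousOn.circleIntegrable (by norm_num) (hd.mul (by fun_prop))

lemma frobeniusTerm_const_mul (β a : ℂ) (c : ℕ → ℂ → ℂ) (m : ℕ) (t : ℂ) :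
    frobeniusTerm β (fun m w => a * c m w) m t = a * frobeniusTerm β c m t := by
  simp only [frobeniusTerm, mul_assoc]
  rw [circleIntegral.integral_const_mul]
  ring

lemma frobeniusSeries_const_mul (β a : ℂ) (c : ℕ → ℂ → ℂ) (t : ℂ) :
    frobeniusSeries β (fun m w => a * c m w) t = a * frobeniusSeries β c t := by
  simp only [frobeniusSeries, frobeniusTerm_const_mul, tsum_mul_left]

lemma RapidlyDecaying.frobeniusSeries_sub_const {c : ℕ → ℂ → ℂ} (hc : RapidlyDecaying c)
    (β a t : ℂ) :
    frobeniusSeries β (fun m w => (β + m + w) * c m w) t - a * frobeniusSeries β c t =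
      frobeniusSeries β (fun m w => (β + m + w - a) * c m w) t := by
  rw [← frobeniusSeries_const_mul, frobeniusSeries, frobeniusSeries, frobeniusSeries,
    ← Summable.tsum_sub ((hc.linear_mul β).summable_norm β t).of_norm
      ((hc.mul (h := fun _ => a) continuousOn_const).summable_norm β t).of_norm]
  refine tsum_congr fun m => ?_
  rw [← frobeniusTerm_sub β ((hc.linear_mul β).1 m)
    ((hc.mul (h := fun _ => a) continuousOn_const).1 m)]
  simp only [frobeniusTerm, sub_mul]

end MeijerEuler

end

/-! ### The reciprocal Gamma product: recursion, decay and zeros -/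

noncomputable section

namespace MeijerEuler

/-- The entire function `ω ↦ ∏ s, 1 / Γ(1 - b s + ω)`. -/
def recipGammaProd {q : ℕ} (b : Fin q → ℂ) (ω : ℂ) : ℂ :=
  ∏ s, (Complex.Gamma (1 - b s + ω))⁻¹

lemma differentiable_recipGammaProd {q : ℕ} (b : Fin q → ℂ) :
    Differentiable ℂ (recipGammaProd b) := by
  unfold recipGammaProd
  refine Differentiable.fun_finsetProd fun s _ => ?_
  exact Complex.differentiable_one_div_Gamma.comp (by fun_prop : Differentiable ℂ fun ω => 1 - b s + ω)

lemma prod_sub_mul_recipGammaProd {q : ℕ} (b : Fin q → ℂ) (ω : ℂ) :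
    (∏ s, (ω + 1 - b s)) * recipGammaProd b (ω + 1) = recipGammaProd b ω := by
  rw [recipGammaProd, recipGammaProd, ← Finset.prod_mul_distrib]
  refine Finset.prod_congr rfl fun s _ => ?_
  rw [Complex.one_div_Gamma_eq_self_mul_one_div_Gamma_add_one (1 - b s + ω)]
  ring_nf

/-- By the recursion, one step `m → m + 1` divides by `∏ s, (ω + 1 - b s)`, whose modulus eventually
exceeds any bound; the ratio test applies for each `R`. -/
lemma rapidlyDecaying_recipGammaProd {q : ℕ} (hq : 1 ≤ q) (b : Fin q → ℂ) (β : ℂ) :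
    RapidlyDecaying fun m w => recipGammaProd b (β + m + w) := by
  have hcont : ∀ m : ℕ, ContinuousOn (fun w => recipGammaProd b (β + m + w))
      (Metric.sphere 0 (1 / 2)) := fun m =>
    ((differentiable_recipGammaProd b).continuous.comp (by fun_prop)).continuousOn
  have hmax : ∀ m : ℕ, ∃ w ∈ Metric.sphere (0 : ℂ) (1 / 2), ∀ v ∈ Metric.sphere (0 : ℂ) (1 / 2),
      ‖recipGammaProd b (β + m + v)‖ ≤ ‖recipGammaProd b (β + m + w)‖ := by
    intro m
    obtain ⟨w, hw, h⟩ := (isCompact_sphere (0 : ℂ) (1 / 2)).exists_isMaxOn ⟨_, half_mem_sphere⟩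
      (hcont m).norm
    exact ⟨w, hw, fun v hv => h hv⟩
  choose x hx hM using hmax
  -- The exact maxima serve as majorants: the recursion at the maximiser for `n + 1` is then bounded
  -- by the maximum for `n`.
  refine ⟨hcont, fun m => ‖recipGammaProd b (β + m + x m)‖, fun m w hw => hM m w hw,
    fun R hR => ?_⟩
  set B : ℝ := ∑ s, ‖b s‖ with hB
  have hbB : ∀ s, ‖b s‖ ≤ B := fun s =>
    Finset.single_le_sum (f := fun s => ‖b s‖) (fun _ _ => norm_nonneg _) (Finset.mem_univ s)
  refine summable_of_ratio_norm_eventually_le (r := 1 / 2) (by norm_num) ?_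
  have hev : ∀ᶠ n : ℕ in atTop, ‖β‖ + B + 2 + 2 * R ≤ (n : ℝ) :=
    tendsto_natCast_atTop_atTop.eventually_ge_atTop _
  filter_upwards [hev] with n hn
  set w := x (n + 1)
  have hw : ‖w‖ = 1 / 2 := by simpa using hx (n + 1)
  have hge : ∀ s, 1 + 2 * R ≤ ‖β + n + w + 1 - b s‖ := by
    intro s
    have h1 : ((n : ℝ) + 1) ≤ ‖β + n + w + 1 - b s‖ + (‖β‖ + ‖w‖ + ‖b s‖) := by
      have e : ((n : ℂ) + 1) = (β + n + w + 1 - b s) - (β + w - b s) := by ring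
      have h2 : ‖(n : ℂ) + 1‖ = n + 1 := by
        have : ((n : ℂ) + 1) = ((n + 1 : ℕ) : ℂ) := by push_cast; rfl
        rw [this, Complex.norm_natCast]; push_cast; rfl
      rw [← h2]
      conv_lhs => rw [e]
      refine (norm_sub_le _ _).trans ?_
      gcongr
      exact (norm_sub_le _ _).trans (by gcongr; exact norm_add_le _ _)
    have := hbB s
    linarith
  have hprod : 1 + 2 * R ≤ ∏ s, ‖β + n + w + 1 - b s‖ := by
    have h1 : (1 + 2 * R) ^ q ≤ ∏ s, ‖β + n + w + 1 - b s‖ := by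
      have := Finset.prod_le_prod (s := (Finset.univ : Finset (Fin q)))
        (f := fun _ => 1 + 2 * R) (fun _ _ => by positivity) (fun s _ => hge s)
      simpa using this
    refine le_trans ?_ h1
    -- Here `q ≥ 1` enters: an empty product would give no decay.
    exact le_self_pow₀ (by linarith) (by omega)
  have hrec := prod_sub_mul_recipGammaProd b (β + n + w)
  have e1 : β + ((n + 1 : ℕ) : ℂ) + w = β + n + w + 1 := by push_cast; ring
  have h3 : (∏ s, ‖β + n + w + 1 - b s‖) * ‖recipGammaProd b (β + n + w + 1)‖ ≤
      ‖recipGammaProd b (β + n + x n)‖ := by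
    rw [← norm_prod, ← norm_mul, hrec]
    exact hM n w (hx (n + 1))
  rw [e1, norm_mul, norm_mul, norm_norm, norm_norm, norm_pow, norm_pow, Real.norm_of_nonneg hR,
    pow_succ]
  have h4 : (1 + 2 * R) * ‖recipGammaProd b (β + n + w + 1)‖ ≤
      ‖recipGammaProd b (β + n + x n)‖ :=
    (mul_le_mul_of_nonneg_right hprod (norm_nonneg _)).trans h3
  have h5 : R * ‖recipGammaProd b (β + n + w + 1)‖ ≤
      1 / 2 * ‖recipGammaProd b (β + n + x n)‖ := by
    nlinarith [norm_nonneg (recipGammaProd b (β + n + w + 1))]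
  calc ‖recipGammaProd b (β + n + w + 1)‖ * (R ^ n * R)
      = R * ‖recipGammaProd b (β + n + w + 1)‖ * R ^ n := by ring
    _ ≤ 1 / 2 * ‖recipGammaProd b (β + n + x n)‖ * R ^ n := by gcongr
    _ = _ := by ring

/-- The zeros of `1 / Γ` are simple: `1 / Γ(z) = z / Γ(z + 1)` carries the zero at `0` to `-1`,
`-2`, and so on. -/
lemma exists_inv_Gamma_neg_nat_factor (n : ℕ) :
    ∃ ψ : ℂ → ℂ, Differentiable ℂ ψ ∧ ψ 0 ≠ 0 ∧
      ∀ w, (Complex.Gamma (-n + w))⁻¹ = w * ψ w := by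
  induction n with
  | zero =>
    refine ⟨fun w => (Complex.Gamma (w + 1))⁻¹,
      Complex.differentiable_one_div_Gamma.comp (by fun_prop : Differentiable ℂ fun w : ℂ => w + 1),
      by simp, fun w => ?_⟩
    simpa using Complex.one_div_Gamma_eq_self_mul_one_div_Gamma_add_one w
  | succ n ih =>
    obtain ⟨ψ, hψ, h0, h⟩ := ih
    refine ⟨fun w => (-((n + 1 : ℕ) : ℂ) + w) * ψ w, by fun_prop, ?_, fun w => ?_⟩
    · have : ((n + 1 : ℕ) : ℂ) ≠ 0 := Nat.cast_ne_zero.2 (Nat.succ_ne_zero n)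
      simpa only [add_zero] using mul_ne_zero (neg_ne_zero.2 this) h0
    · rw [Complex.one_div_Gamma_eq_self_mul_one_div_Gamma_add_one]
      have e : -((n + 1 : ℕ) : ℂ) + w + 1 = -n + w := by push_cast; ring
      rw [e, h]
      ring

open Classical in
lemma exists_inv_Gamma_factor (x : ℂ) :
    ∃ ψ : ℂ → ℂ, Differentiable ℂ ψ ∧ ψ 0 ≠ 0 ∧
      ∀ w, (Complex.Gamma (x + w))⁻¹ = w ^ (if ∃ n : ℕ, x = -n then 1 else 0) * ψ w := by
  by_cases hx : ∃ n : ℕ, x = -n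
  · obtain ⟨n, rfl⟩ := hx
    simpa using exists_inv_Gamma_neg_nat_factor n
  · refine ⟨fun w => (Complex.Gamma (x + w))⁻¹,
      Complex.differentiable_one_div_Gamma.comp (by fun_prop : Differentiable ℂ fun w : ℂ => x + w),
      ?_, fun w => by simp [hx]⟩
    push Not at hx
    simpa using Complex.Gamma_ne_zero hx

open Classical in
/-- The order of vanishing of `∏ s, 1 / Γ(1 - b s + ω)` at a point. -/
lemma exists_recipGammaProd_factor {q : ℕ} (b : Fin q → ℂ) (x : ℂ) :
    ∃ ψ : ℂ → ℂ, Differentiable ℂ ψ ∧ ψ 0 ≠ 0 ∧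
      ∀ w, recipGammaProd b (x + w) =
        w ^ (Finset.univ.filter fun s => ∃ n : ℕ, 1 - b s + x = -n).card * ψ w := by
  choose ψ hψ h0 h using fun s => exists_inv_Gamma_factor (1 - b s + x)
  refine ⟨fun w => ∏ s, ψ s w, Differentiable.fun_finsetProd fun s _ => hψ s,
    Finset.prod_ne_zero_iff.2 fun s _ => h0 s, fun w => ?_⟩
  rw [recipGammaProd, Finset.card_filter, ← Finset.prod_pow_eq_pow_sum, ← Finset.prod_mul_distrib]
  refine Finset.prod_congr rfl fun s _ => ?_
  rw [← h s w, add_assoc]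

lemma sin_pi_mul_ne_zero {w : ℂ} (hw : ‖w‖ < 1) (h0 : w ≠ 0) :
    Complex.sin (Real.pi * w) ≠ 0 := by
  rw [Ne, Complex.sin_eq_zero_iff]
  rintro ⟨k, hk⟩
  have hpi : (Real.pi : ℂ) ≠ 0 := by exact_mod_cast Real.pi_ne_zero
  have hwk : w = k := mul_left_cancel₀ hpi (hk.trans (mul_comm _ _))
  subst hwk
  rw [Complex.norm_intCast] at hw
  have : |k| < 1 := by exact_mod_cast hw
  exact h0 (by simp [Int.abs_lt_one_iff.1 this])

/-- `π / sin (π w) = σ w / w` with `σ` holomorphic in the unit disc and `σ 0 = 1`. -/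
lemma exists_pi_div_sin_factor :
    ∃ σ : ℂ → ℂ, DifferentiableOn ℂ σ (Metric.ball 0 1) ∧ σ 0 = 1 ∧
      ∀ w ∈ Metric.ball (0 : ℂ) 1, w ≠ 0 → Real.pi / Complex.sin (Real.pi * w) = w⁻¹ * σ w := by
  have hpi : (Real.pi : ℂ) ≠ 0 := by exact_mod_cast Real.pi_ne_zero
  set f : ℂ → ℂ := fun w => Complex.sin (Real.pi * w) with hf
  have hfd : Differentiable ℂ f := by fun_prop
  have hder : HasDerivAt f Real.pi 0 := by
    have := ((hasDerivAt_id (0 : ℂ)).const_mul (Real.pi : ℂ)).csin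
    simpa using this
  have hd : DifferentiableOn ℂ (dslope f 0) (Metric.ball 0 1) :=
    (Complex.differentiableOn_dslope (Metric.ball_mem_nhds 0 one_pos)).2 hfd.differentiableOn
  have h0 : dslope f 0 0 = Real.pi := by rw [dslope_same, hder.deriv]
  have hw : ∀ w : ℂ, w ≠ 0 → dslope f 0 w = w⁻¹ * f w := by
    intro w hw
    rw [dslope_of_ne _ hw, slope_def_field]
    simp [hf, div_eq_inv_mul]
  refine ⟨fun w => Real.pi / dslope f 0 w, ?_, by simp only [h0, div_self hpi], ?_⟩
  · refine DifferentiableOn.div (differentiableOn_const _) hd fun w hwb => ?_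
    by_cases h : w = 0
    · rw [h, h0]; exact hpi
    · rw [hw w h]
      exact mul_ne_zero (inv_ne_zero h) (sin_pi_mul_ne_zero (by simpa using hwb) h)
  · intro w hwb h
    simp only [hw w h]
    have := sin_pi_mul_ne_zero (by simpa using hwb) h
    simp only [hf]
    field_simp

/-- The coefficient functions of Meijer's function with `ℓ` upper parameters, all congruent to `β`
modulo `ℤ`, up to a constant factor. -/
def meijerCoeff {q : ℕ} (b : Fin q → ℂ) (β : ℂ) (ℓ m : ℕ) (w : ℂ) : ℂ :=
  (Real.pi / Complex.sin (Real.pi * w)) ^ ℓ * ((-1) ^ (m * ℓ) * recipGammaProd b (β + m + w))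

lemma continuousOn_pi_div_sin_pow (ℓ : ℕ) :
    ContinuousOn (fun w : ℂ => (Real.pi / Complex.sin (Real.pi * w)) ^ ℓ)
      (Metric.sphere 0 (1 / 2)) := by
  refine ContinuousOn.pow (ContinuousOn.div (by fun_prop) (by fun_prop) fun w hw => ?_) _
  have : ‖w‖ = 1 / 2 := by simpa using hw
  exact sin_pi_mul_ne_zero (by rw [this]; norm_num) (by rintro rfl; norm_num at this)

lemma rapidlyDecaying_meijerCoeff {q : ℕ} (hq : 1 ≤ q) (b : Fin q → ℂ) (β : ℂ) (ℓ : ℕ) :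
    RapidlyDecaying (meijerCoeff b β ℓ) := by
  refine RapidlyDecaying.mul ?_ (continuousOn_pi_div_sin_pow ℓ)
  obtain ⟨hc, M, hM, hs⟩ := rapidlyDecaying_recipGammaProd hq b β
  refine ⟨fun m => continuousOn_const.mul (hc m), M, fun m w hw => ?_, hs⟩
  simpa using hM m w hw

/-! ### Residues of the Mellin–Barnes integrand as Frobenius terms -/

lemma circleIntegral_translate (f : ℂ → ℂ) (a : ℂ) (r : ℝ) :
    ∮ ω in C(a, r), f ω = ∮ w in C(0, r), f (a + w) := by
  simp [circleIntegral, circleMap]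

lemma residue_eq_of_circleIntegral_eq {f : ℂ → ℂ} {a I : ℂ}
    (h : ∀ r : ℝ, 0 < r → r < 1 → ∮ w in C(a, r), f w = I) :
    residue f a = (2 * Real.pi * Complex.I)⁻¹ * I := by
  refine Tendsto.limUnder_eq (tendsto_const_nhds.congr' ?_)
  filter_upwards [Ioo_mem_nhdsGT (zero_lt_one' ℝ)] with r hr
  rw [h r hr.1 hr.2]

/-- The reflection formula. Integer shifts change the sine only by a sign, so its singular factor is
the same at every pole. -/
lemma Gamma_sub_eq {m n : ℕ} {β w : ℂ} (hw : ‖w‖ < 1) (h0 : w ≠ 0) :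
    Complex.Gamma (β + n - (β + m + w)) =
      -(-1) ^ n * (-1) ^ m * (Real.pi / Complex.sin (Real.pi * w)) *
        (Complex.Gamma (1 - (β + n) + (β + m + w)))⁻¹ := by
  -- A zero of Mathlib's `Gamma` would make `w` an integer, which `0 < ‖w‖ < 1` excludes.
  have hne : Complex.Gamma (1 - (β + n) + (β + m + w)) ≠ 0 := by
    refine Complex.Gamma_ne_zero fun k hk => ?_
    have hwi : w = ((n - m - 1 - k : ℤ) : ℂ) := by push_cast; linear_combination hk
    rw [hwi, Complex.norm_intCast] at hw
    have h1 : |(n - m - 1 - k : ℤ)| < 1 := by exact_mod_cast hw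
    exact h0 (by rw [hwi, Int.abs_lt_one_iff.1 h1]; simp)
  have hsin : Complex.sin (Real.pi * (β + n - (β + m + w))) =
      -(-1) ^ n * (-1) ^ m * Complex.sin (Real.pi * w) := by
    have e : Real.pi * (β + n - (β + m + w)) = -(Real.pi * w) - m * Real.pi + n * Real.pi := by ring
    rw [e, Complex.sin_antiperiodic.add_nat_mul_eq, Complex.sin_antiperiodic.sub_nat_mul_eq,
      Complex.sin_neg]
    ring
  have key := Complex.Gamma_mul_Gamma_one_sub (β + n - (β + m + w))
  have e2 : 1 - (β + n - (β + m + w)) = 1 - (β + n) + (β + m + w) := by ring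
  rw [e2, hsin] at key
  rw [eq_mul_inv_iff_mul_eq₀ hne, key]
  have hs := sin_pi_mul_ne_zero hw h0
  have hn : ((-1 : ℂ) ^ n) * (-1) ^ n = 1 := by rw [← mul_pow]; simp
  have hm : ((-1 : ℂ) ^ m) * (-1) ^ m = 1 := by rw [← mul_pow]; simp
  have hn0 : ((-1 : ℂ) ^ n) ≠ 0 := by simp
  have hm0 : ((-1 : ℂ) ^ m) ≠ 0 := by simp
  field_simp
  linear_combination ((-1 : ℂ) ^ n * (-1) ^ n) * hm + hn

variable {q : ℕ} {b : Fin q → ℂ} {S : Finset (Fin q)} {β : ℂ} {n : Fin q → ℕ}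

/-- After reflection the reciprocal Gammas over `S` join those over `Sᶜ` into the product over all
parameters. Thus `S` survives only through its cardinality and a constant sign. -/
lemma meijerIntegrand_eq (hS : ∀ s ∈ S, b s = β + n s) (m : ℕ) {w : ℂ} (hw : ‖w‖ < 1)
    (h0 : w ≠ 0) (t : ℂ) :
    meijerIntegrand b S t (β + m + w) =
      (∏ s ∈ S, -(-1) ^ n s) * (meijerCoeff b β S.card m w * Complex.exp ((β + m + w) * t)) := by
  have h1 : ∏ s ∈ S, Complex.Gamma (b s - (β + m + w)) =
      (∏ s ∈ S, -(-1) ^ n s) * ((-1) ^ m) ^ S.card *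
        (Real.pi / Complex.sin (Real.pi * w)) ^ S.card *
        ∏ s ∈ S, (Complex.Gamma (1 - b s + (β + m + w)))⁻¹ := by
    rw [← Finset.prod_const, ← Finset.prod_const, ← Finset.prod_mul_distrib,
      ← Finset.prod_mul_distrib, ← Finset.prod_mul_distrib]
    refine Finset.prod_congr rfl fun s hs => ?_
    rw [hS s hs, Gamma_sub_eq hw h0]
  have h2 : recipGammaProd b (β + m + w) =
      (∏ s ∈ S, (Complex.Gamma (1 - b s + (β + m + w)))⁻¹) *
        (∏ s ∈ Sᶜ, Complex.Gamma (1 - b s + (β + m + w)))⁻¹ := by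
    rw [recipGammaProd, ← Finset.prod_mul_prod_compl S, Finset.prod_inv_distrib,
      Finset.prod_inv_distrib]
  rw [meijerIntegrand, h1, meijerCoeff, h2, pow_mul, div_eq_mul_inv]
  ring

/-- The integrand is holomorphic in the punctured unit disc about the pole, so the circle of radius
`1 / 2` gives the same integral as arbitrarily small ones. -/
lemma residue_meijerIntegrand (hS : ∀ s ∈ S, b s = β + n s) (m : ℕ) (t : ℂ) :
    residue (meijerIntegrand b S t) (β + m) =
      (∏ s ∈ S, -(-1) ^ n s) * frobeniusTerm β (meijerCoeff b β S.card) m t := by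
  set f : ℂ → ℂ := fun w => meijerCoeff b β S.card m w * Complex.exp ((β + m + w) * t) with hf
  have hdiff : ∀ w : ℂ, ‖w‖ < 1 → w ≠ 0 → DifferentiableAt ℂ f w := by
    intro w hw h0
    have hs := sin_pi_mul_ne_zero hw h0
    have hE : DifferentiableAt ℂ (fun w => recipGammaProd b (β + m + w)) w :=
      ((differentiable_recipGammaProd b).comp
        (by fun_prop : Differentiable ℂ fun w => β + m + w)).differentiableAt
    simp only [hf, meijerCoeff]
    refine DifferentiableAt.mul (DifferentiableAt.mul ?_ (hE.const_mul _)) (by fun_prop)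
    have hd : DifferentiableAt ℂ (fun w : ℂ => (Real.pi : ℂ) / Complex.sin (Real.pi * w)) w :=
      DifferentiableAt.fun_div (by fun_prop) (by fun_prop) hs
    exact hd.fun_pow _
  have hannulus : ∀ r R : ℝ, 0 < r → r ≤ R → R < 1 →
      ∮ w in C(0, R), f w = ∮ w in C(0, r), f w := by
    intro r R hr hrR hR
    refine Complex.circleIntegral_eq_of_differentiable_on_annulus_off_countable hr hrR
      Set.countable_empty ?_ ?_
    · intro w hw
      have h1 : ‖w‖ ≤ R := by simpa using hw.1
      have h2 : r ≤ ‖w‖ := by simpa using hw.2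
      exact (hdiff w (by linarith) (norm_pos_iff.1 (by linarith))).continuousAt.continuousWithinAt
    · intro w hw
      have h1 : ‖w‖ < R := by simpa using hw.1.1
      have h2 : r < ‖w‖ := by simpa using hw.1.2
      exact hdiff w (by linarith) (norm_pos_iff.1 (by linarith))
  have hhalf : ∀ r : ℝ, 0 < r → r < 1 → ∮ w in C(0, r), f w = ∮ w in C(0, 1 / 2), f w := by
    intro r h0 h1
    rcases le_total r (1 / 2) with h | h
    · exact (hannulus r (1 / 2) h0 h (by norm_num)).symm
    · exact hannulus (1 / 2) r (by norm_num) h h1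
  rw [residue_eq_of_circleIntegral_eq (I := (∏ s ∈ S, -(-1) ^ n s) * ∮ w in C(0, 1 / 2), f w)]
  · rw [frobeniusTerm]; ring
  · intro r h0 h1
    rw [circleIntegral_translate, ← hhalf r h0 h1, ← circleIntegral.integral_const_mul]
    refine circleIntegral.integral_congr h0.le fun w hw => ?_
    have hw' : ‖w‖ = r := by simpa using hw
    exact meijerIntegrand_eq hS m (by linarith) (norm_pos_iff.1 (by linarith)) t

lemma meijerPoles_eq_range (hS : ∀ s ∈ S, b s = β + n s) (hβ : ∃ s ∈ S, b s = β) :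
    meijerPoles b S = Set.range fun m : ℕ => β + m := by
  ext ω
  constructor
  · rintro ⟨s, hs, k, rfl⟩
    exact ⟨n s + k, by rw [hS s hs]; push_cast; ring⟩
  · rintro ⟨m, rfl⟩
    obtain ⟨s, hs, h⟩ := hβ
    exact ⟨s, hs, m, by rw [h]⟩

/-- The poles of the integrand, numbered by the natural numbers. -/
def polesEquiv (hS : ∀ s ∈ S, b s = β + n s) (hβ : ∃ s ∈ S, b s = β) : ℕ ≃ meijerPoles b S :=
  (Equiv.ofInjective (fun m : ℕ => β + m) fun i j h => by simpa using h).trans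
    (Equiv.setCongr (meijerPoles_eq_range hS hβ).symm)

lemma polesEquiv_apply (hS : ∀ s ∈ S, b s = β + n s) (hβ : ∃ s ∈ S, b s = β) (m : ℕ) :
    (polesEquiv hS hβ m : ℂ) = β + m := rfl

lemma summable_norm_residue (hq : 1 ≤ q) (hS : ∀ s ∈ S, b s = β + n s) (hβ : ∃ s ∈ S, b s = β)
    (t : ℂ) :
    Summable fun ω : meijerPoles b S => ‖residue (meijerIntegrand b S t) (ω : ℂ)‖ := by
  rw [← (polesEquiv hS hβ).summable_iff]
  refine (((rapidlyDecaying_meijerCoeff hq b β S.card).summable_norm β t).mul_left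
    ‖∏ s ∈ S, (-(-1 : ℂ) ^ n s)‖).congr fun m => ?_
  rw [Function.comp, polesEquiv_apply, residue_meijerIntegrand hS, norm_mul]

lemma meijerG_eq_frobeniusSeries (hS : ∀ s ∈ S, b s = β + n s) (hβ : ∃ s ∈ S, b s = β) (t : ℂ) :
    meijerG b S t =
      (-∏ s ∈ S, -(-1) ^ n s) * frobeniusSeries β (meijerCoeff b β S.card) t := by
  rw [meijerG, ← (polesEquiv hS hβ).tsum_eq, frobeniusSeries, neg_mul, ← tsum_mul_left]
  congr 1
  refine tsum_congr fun m => ?_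
  rw [polesEquiv_apply, residue_meijerIntegrand hS]

lemma sign_ne_zero (S : Finset (Fin q)) (n : Fin q → ℕ) :
    (-∏ s ∈ S, -(-1 : ℂ) ^ n s) ≠ 0 :=
  neg_ne_zero.2 (Finset.prod_ne_zero_iff.2 fun s _ => by simp)

end MeijerEuler

end

/-! ### The differential equation -/

noncomputable section

namespace MeijerEuler

lemma hasDerivAt_log_branch {U : Set ℂ} (hUo : IsOpen U) {L : ℂ → ℂ} (hL : ContinuousOn L U)
    {ε : ℂ} (hε : ε ≠ 0) (h : ∀ ζ ∈ U, Complex.exp (L ζ) = ε * ζ) {ζ : ℂ} (hζ : ζ ∈ U) :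
    HasDerivAt L ζ⁻¹ ζ := by
  have h1 : HasDerivAt (fun t => ε⁻¹ * Complex.exp t) ζ (L ζ) := by
    have := (Complex.hasDerivAt_exp (L ζ)).const_mul ε⁻¹
    rwa [h ζ hζ, inv_mul_cancel_left₀ hε] at this
  have h0 : ζ ≠ 0 := by
    rintro rfl
    have := h 0 hζ
    simp at this
  refine HasDerivAt.of_local_left_inverse (hL.continuousAt (hUo.mem_nhds hζ)) h1 h0 ?_
  filter_upwards [hUo.mem_nhds hζ] with y hy
  rw [h y hy, inv_mul_cancel_left₀ hε]

/-- In the variable `t = L ζ` the operator `ζ d/dζ` is `d/dt`, which multiplies the coefficient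
functions by `β + m + w`. -/
lemma foldr_eulerFactor_frobeniusSeries {U : Set ℂ} (hUo : IsOpen U) (hU0 : (0 : ℂ) ∉ U)
    {L : ℂ → ℂ} (hL : ∀ ζ ∈ U, HasDerivAt L ζ⁻¹ ζ) {c : ℕ → ℂ → ℂ} (hc : RapidlyDecaying c)
    (a β : ℂ) (l : List ℂ) :
    ∀ ζ ∈ U, l.foldr eulerFactor (fun ζ => a * frobeniusSeries β c (L ζ)) ζ =
      a * frobeniusSeries β (fun m w => (l.map fun x => β + m + w - x).prod * c m w) (L ζ) := by
  induction l with
  | nil => simp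
  | cons x l ih =>
    intro ζ hζ
    have hl := hc.list_prod_mul β l
    have hd : HasDerivAt (l.foldr eulerFactor (fun ζ => a * frobeniusSeries β c (L ζ))) _ ζ :=
      (((hl.hasDerivAt β (L ζ)).comp ζ (hL ζ hζ)).const_mul a).congr_of_eventuallyEq
        (by filter_upwards [hUo.mem_nhds hζ] with y hy using ih y hy)
    have h0 : ζ ≠ 0 := fun h => hU0 (h ▸ hζ)
    rw [List.foldr_cons, eulerFactor, hd.deriv, ih ζ hζ]
    have key := hl.frobeniusSeries_sub_const β x (L ζ)
    have e : (fun (m : ℕ) w => ((x :: l).map fun x => β + m + w - x).prod * c m w) =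
        fun (m : ℕ) w => (β + m + w - x) * ((l.map fun x => β + m + w - x).prod * c m w) := by
      funext m w
      simp only [List.map_cons, List.prod_cons]
      ring
    rw [e, ← key]
    field_simp

lemma frobeniusTerm_congr {β : ℂ} {c d : ℕ → ℂ → ℂ} {m : ℕ}
    (h : ∀ w ∈ Metric.sphere (0 : ℂ) (1 / 2), c m w = d m w) (t : ℂ) :
    frobeniusTerm β c m t = frobeniusTerm β d m t := by
  rw [frobeniusTerm, frobeniusTerm]
  congr 1
  exact circleIntegral.integral_congr (by norm_num) fun w hw => by simp only [h w hw]

lemma frobeniusTerm_shift (β : ℂ) (c : ℕ → ℂ → ℂ) (m : ℕ) (t : ℂ) :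
    frobeniusTerm β c (m + 1) t =
      Complex.exp t * frobeniusTerm β (fun m w => c (m + 1) w) m t := by
  rw [frobeniusTerm, frobeniusTerm, mul_left_comm (Complex.exp t),
    ← circleIntegral.integral_const_mul (Complex.exp t)]
  congr 2
  funext w
  have e : (β + ((m + 1 : ℕ) : ℂ) + w) * t = t + (β + m + w) * t := by push_cast; ring
  rw [e, Complex.exp_add]
  ring

variable {q : ℕ} {b : Fin q → ℂ} {S : Finset (Fin q)} {β : ℂ} {n : Fin q → ℕ}

lemma sphere_half_prop {w : ℂ} (hw : w ∈ Metric.sphere (0 : ℂ) (1 / 2)) :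
    w ∈ Metric.ball (0 : ℂ) 1 ∧ w ≠ 0 := by
  have h : ‖w‖ = 1 / 2 := by simpa using hw
  refine ⟨by simp [h]; norm_num, norm_pos_iff.1 (by rw [h]; norm_num)⟩

lemma DifferentiableOn.diffContOnCl_ball_half {f : ℂ → ℂ}
    (hf : DifferentiableOn ℂ f (Metric.ball 0 1)) : DiffContOnCl ℂ f (Metric.ball 0 (1 / 2)) := by
  refine hf.diffContOnCl_ball ?_
  intro w hw
  have : ‖w‖ ≤ 1 / 2 := by simpa using hw
  simp only [Metric.mem_ball, dist_zero_right]
  linarith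

/-- The indicial equation: the term that the recursion leaves over vanishes. -/
lemma frobeniusTerm_zero_eq_zero (hS : ∀ s ∈ S, b s = β + n s) (t : ℂ) :
    frobeniusTerm β (fun m w => (∏ s, (β + m + w - b s)) * meijerCoeff b β S.card m w) 0 t = 0 := by
  classical
  obtain ⟨σ, hσ, -, hσw⟩ := exists_pi_div_sin_factor
  -- The recursion turns `∏ s, (β + w - b s)` times the reciprocal Gamma product at `β + w` into
  -- that product at `β - 1 + w`. There each `s ∈ S` contributes a zero, since `1 - b s + (β - 1) =
  -- -n s`.
  obtain ⟨ψ, hψ, -, h⟩ := exists_recipGammaProd_factor b (β - 1)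
  set N := (Finset.univ.filter fun s => ∃ n : ℕ, 1 - b s + (β - 1) = -n).card
  have hN : S.card ≤ N := by
    refine Finset.card_le_card fun s hs => ?_
    rw [Finset.mem_filter]
    exact ⟨Finset.mem_univ _, n s, by rw [hS s hs]; ring⟩
  rw [frobeniusTerm, circleIntegral.integral_congr (by norm_num)
    (g := fun w => w ^ (N - S.card) * σ w ^ S.card * ψ w * Complex.exp ((β + w) * t))]
  · rw [DiffContOnCl.circleIntegral_eq_zero (by norm_num), mul_zero]
    refine DifferentiableOn.diffContOnCl_ball_half ?_
    have := hψ.differentiableOn (s := Metric.ball 0 1)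
    fun_prop
  · intro w hw
    obtain ⟨hw1, hw0⟩ := sphere_half_prop hw
    have hrec := prod_sub_mul_recipGammaProd b (β - 1 + w)
    have e : β - 1 + w + 1 = β + w := by ring
    rw [e, h w] at hrec
    have e2 : w ^ N = w ^ (N - S.card) * w ^ S.card := by rw [← pow_add]; congr 1; omega
    simp only [meijerCoeff, Nat.cast_zero, add_zero, zero_mul, pow_zero, one_mul]
    rw [mul_left_comm, hrec, hσw w hw1 hw0, e2, mul_pow, inv_pow]
    field_simp

lemma meijerCoeff_recursion (b : Fin q → ℂ) (β : ℂ) (ℓ m : ℕ) (w : ℂ) :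
    (∏ s, (β + (m + 1 : ℕ) + w - b s)) * meijerCoeff b β ℓ (m + 1) w =
      (-1) ^ ℓ * meijerCoeff b β ℓ m w := by
  have hrec := prod_sub_mul_recipGammaProd b (β + m + w)
  have e : β + ((m + 1 : ℕ) : ℂ) + w = β + m + w + 1 := by push_cast; ring
  simp only [meijerCoeff]
  rw [← hrec, e, add_mul, pow_add, one_mul]
  ring

/-- The `m = 0` term drops out, and the recursion identifies term `m + 1` with `(-1) ^ ℓ * exp t`
times the original term `m`. -/
lemma frobeniusSeries_prod_meijerCoeff (hq : 1 ≤ q) (hS : ∀ s ∈ S, b s = β + n s) (t : ℂ) :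
    frobeniusSeries β (fun m w => ((List.ofFn b).map fun x => β + m + w - x).prod *
        meijerCoeff b β S.card m w) t =
      (-1) ^ S.card * Complex.exp t * frobeniusSeries β (meijerCoeff b β S.card) t := by
  have hs := (((rapidlyDecaying_meijerCoeff hq b β S.card).list_prod_mul β
    (List.ofFn b)).summable_norm β t).of_norm
  have e : (fun (m : ℕ) w => ((List.ofFn b).map fun x => β + m + w - x).prod *
        meijerCoeff b β S.card m w) =
      fun (m : ℕ) w => (∏ s, (β + m + w - b s)) * meijerCoeff b β S.card m w := by
    funext m w
    rw [List.map_ofFn, List.prod_ofFn]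
    rfl
  rw [frobeniusSeries, hs.tsum_eq_zero_add, e, frobeniusTerm_zero_eq_zero hS, zero_add,
    frobeniusSeries, ← tsum_mul_left]
  refine tsum_congr fun m => ?_
  rw [frobeniusTerm_shift]
  have := frobeniusTerm_congr (β := β) (m := m)
    (c := fun m w => (∏ s, (β + (m + 1 : ℕ) + w - b s)) * meijerCoeff b β S.card (m + 1) w)
    (d := fun m w => (-1) ^ S.card * meijerCoeff b β S.card m w)
    (fun w _ => meijerCoeff_recursion b β S.card m w) t
  rw [this, frobeniusTerm_const_mul]
  ring

lemma isSolution_meijerG (hq : 1 ≤ q) (hS : ∀ s ∈ S, b s = β + n s) (hβ : ∃ s ∈ S, b s = β)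
    {U : Set ℂ} (hUo : IsOpen U) (hU0 : (0 : ℂ) ∉ U) {L : ℂ → ℂ} (hLc : ContinuousOn L U)
    (hL : ∀ ζ ∈ U, Complex.exp (L ζ) = (-1) ^ S.card * ζ) :
    IsSolution b U fun ζ => meijerG b S (L ζ) := by
  have hd : ∀ ζ ∈ U, HasDerivAt L ζ⁻¹ ζ := fun ζ hζ =>
    hasDerivAt_log_branch hUo hLc (by simp) hL hζ
  have hc := rapidlyDecaying_meijerCoeff hq b β S.card
  simp only [meijerG_eq_frobeniusSeries hS hβ]
  refine ⟨fun ζ hζ => ?_, fun ζ hζ => ?_⟩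
  · exact (((hc.hasDerivAt β (L ζ)).comp ζ (hd ζ hζ)).const_mul
      _).differentiableAt.differentiableWithinAt
  · rw [eulerProd, foldr_eulerFactor_frobeniusSeries hUo hU0 hd hc _ β _ ζ hζ,
      frobeniusSeries_prod_meijerCoeff hq hS, hL ζ hζ]
    have : ((-1 : ℂ) ^ S.card) * (-1) ^ S.card = 1 := by rw [← mul_pow]; simp
    linear_combination ((-∏ s ∈ S, -(-1) ^ n s) *
      (ζ * frobeniusSeries β (meijerCoeff b β S.card) (L ζ))) * this

lemma differentiable_meijerG (hq : 1 ≤ q) (hS : ∀ s ∈ S, b s = β + n s)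
    (hβ : ∃ s ∈ S, b s = β) : Differentiable ℂ (meijerG b S) := by
  have : meijerG b S = fun t =>
      (-∏ s ∈ S, -(-1) ^ n s) * frobeniusSeries β (meijerCoeff b β S.card) t :=
    funext (meijerG_eq_frobeniusSeries hS hβ)
  rw [this]
  exact fun t => (((rapidlyDecaying_meijerCoeff hq b β S.card).hasDerivAt β t).const_mul
    _).differentiableAt

/-! ### Simple poles and the hypergeometric series -/

lemma frobeniusTerm_meijerCoeff_one (b : Fin q → ℂ) (β : ℂ) (m : ℕ) (t : ℂ) :
    frobeniusTerm β (meijerCoeff b β 1) m t =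
      (-1) ^ m * recipGammaProd b (β + m) * Complex.exp ((β + m) * t) := by
  obtain ⟨σ, hσ, hσ0, hσw⟩ := exists_pi_div_sin_factor
  set g : ℂ → ℂ := fun w => σ w * ((-1) ^ m * recipGammaProd b (β + m + w)) *
    Complex.exp ((β + m + w) * t)
  have hE : Differentiable ℂ fun w => recipGammaProd b (β + m + w) :=
    (differentiable_recipGammaProd b).comp (by fun_prop : Differentiable ℂ fun w => β + m + w)
  have hg : DifferentiableOn ℂ g (Metric.ball 0 1) := by
    have := hE.differentiableOn (s := Metric.ball 0 1)
    fun_prop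
  have h := (DifferentiableOn.diffContOnCl_ball_half hg).two_pi_i_inv_smul_circleIntegral_sub_inv_smul
    (w := 0) (by simp)
  rw [frobeniusTerm, circleIntegral.integral_congr (by norm_num)
    (g := fun w => (w - 0)⁻¹ • g w)]
  · rw [← smul_eq_mul, h]
    simp [g, hσ0]
  · intro w hw
    obtain ⟨hw1, hw0⟩ := sphere_half_prop hw
    simp only [meijerCoeff, hσw w hw1 hw0, g, sub_zero, smul_eq_mul, mul_one, pow_one]
    ring

lemma meijerG_singleton (j : Fin q) (hne : ∀ i, ∀ k : ℕ, 1 + b j - b i ≠ -k) {t ζ : ℂ}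
    (ht : Complex.exp t = -ζ) :
    meijerG b {j} t = Complex.exp (b j * t) / (∏ i, Complex.Gamma (1 + b j - b i)) *
      hypergeometricZeroF (fun i : {i // i ≠ j} => 1 + b j - b i) ζ := by
  rw [meijerG_eq_frobeniusSeries (β := b j) (n := fun _ => 0) (by simp) ⟨j, by simp⟩,
    frobeniusSeries, hypergeometricZeroF, ← tsum_mul_left, ← tsum_mul_left]
  refine tsum_congr fun m => ?_
  rw [Finset.card_singleton, frobeniusTerm_meijerCoeff_one]
  have hG : ∀ i, Complex.Gamma (1 + b j - b i) ≠ 0 := fun i => Complex.Gamma_ne_zero (hne i)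
  have hE : recipGammaProd b (b j + m) = (∏ i, Complex.Gamma (1 + b j - b i))⁻¹ *
      ((∏ i : {i // i ≠ j}, (ascPochhammer ℂ m).eval (1 + b j - b i)) * (m.factorial : ℂ))⁻¹ := by
    have h1 : ∀ i, Complex.Gamma (1 - b i + (b j + m)) =
        Complex.Gamma (1 + b j - b i) * (ascPochhammer ℂ m).eval (1 + b j - b i) := by
      intro i
      rw [← Complex.Gamma_add_nat_div_Gamma_eq _ (hne i), mul_div_cancel₀ _ (hG i)]
      congr 1
      ring
    -- The factor `i = j` is `(1)_m = m!`, the factorial in the hypergeometric series.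
    have h2 : (∏ i, (ascPochhammer ℂ m).eval (1 + b j - b i)) =
        (∏ i : {i // i ≠ j}, (ascPochhammer ℂ m).eval (1 + b j - b i)) * (m.factorial : ℂ) := by
      rw [← Finset.prod_erase_mul _ _ (Finset.mem_univ j), add_sub_cancel_right,
        ascPochhammer_eval_one]
      congr 1
      refine Finset.prod_subtype _ (fun i => ?_) _
      simp
    rw [recipGammaProd, Finset.prod_inv_distrib, Finset.prod_congr rfl fun i _ => h1 i,
      Finset.prod_mul_distrib, h2, mul_inv]
  have hexp : Complex.exp ((b j + m) * t) = Complex.exp (b j * t) * (-ζ) ^ m := by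
    rw [add_mul, Complex.exp_add, Complex.exp_nat_mul, ht]
  rw [hE, hexp, neg_pow ζ m]
  have h1 : ((-1 : ℂ) ^ m) * (-1) ^ m = 1 := by rw [← mul_pow]; simp
  simp only [Finset.prod_singleton, pow_zero, neg_neg, one_mul, div_eq_mul_inv]
  linear_combination (Complex.exp (b j * t) * ζ ^ m * (∏ i, Complex.Gamma (1 + b j - b i))⁻¹ *
      ((∏ i : {i // i ≠ j}, (ascPochhammer ℂ m).eval (1 + b j - b i)) * (m.factorial : ℂ))⁻¹) * h1

end MeijerEuler

end

/-! ### Leading behaviour at the origin -/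

noncomputable section

namespace MeijerEuler

/-- Cauchy's formula for the `k`-th derivative together with Leibniz' rule: a pole of order at most
`k + 1` produces a polynomial of degree at most `k` in `t`, the logarithm. -/
lemma inv_mul_circleIntegral_inv_pow_mul_exp {φ : ℂ → ℂ}
    (hφ : DifferentiableOn ℂ φ (Metric.ball 0 1)) (k : ℕ) (t : ℂ) :
    (2 * Real.pi * Complex.I)⁻¹ * ∮ w in C(0, 1 / 2), (w ^ (k + 1))⁻¹ * (φ w * Complex.exp (w * t)) =
      ((k.factorial : ℂ))⁻¹ *
        ∑ i ∈ Finset.range (k + 1), (k.choose i : ℂ) * iteratedDeriv i φ 0 * t ^ (k - i) := by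
  have hg : DifferentiableOn ℂ (fun w => φ w * Complex.exp (w * t)) (Metric.ball 0 1) := by
    fun_prop
  have h := (DifferentiableOn.diffContOnCl_ball_half hg).circleIntegral_one_div_sub_center_pow_smul
    (by norm_num) k
  simp only [sub_zero, one_div, smul_eq_mul] at h
  have hφa : AnalyticAt ℂ φ 0 := hφ.analyticAt (Metric.ball_mem_nhds 0 one_pos)
  have hea : AnalyticAt ℂ (fun w : ℂ => Complex.exp (w * t)) 0 :=
    (by fun_prop : Differentiable ℂ fun w : ℂ => Complex.exp (w * t)).analyticAt 0
  rw [one_div, h, iteratedDeriv_fun_mul hφa.contDiffAt hea.contDiffAt]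
  have hpi : (2 * Real.pi * Complex.I : ℂ) ≠ 0 := Complex.two_pi_I_ne_zero
  have e : ∀ i, iteratedDeriv i (fun w : ℂ => Complex.exp (w * t)) 0 = t ^ i := by
    intro i
    simp only [mul_comm _ t]
    rw [iteratedDeriv_cexp_const_mul]
    simp
  simp only [e]
  field_simp

lemma tendsto_inv_mul_circleIntegral {φ : ℂ → ℂ} (hφ : DifferentiableOn ℂ φ (Metric.ball 0 1))
    (k : ℕ) {F : Filter ℂ} (hF : Tendsto (fun t : ℂ => ‖t‖) F atTop) :
    Tendsto (fun t : ℂ => ((2 * Real.pi * Complex.I)⁻¹ * ∮ w in C(0, 1 / 2),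
      (w ^ (k + 1))⁻¹ * (φ w * Complex.exp (w * t))) / t ^ k) F
      (𝓝 (((k.factorial : ℂ))⁻¹ * φ 0)) := by
  simp only [inv_mul_circleIntegral_inv_pow_mul_exp hφ, mul_div_assoc, Finset.sum_div]
  refine Tendsto.const_mul _ ?_
  have hinv : Tendsto (fun t : ℂ => t⁻¹) F (𝓝 0) := by
    rw [tendsto_zero_iff_norm_tendsto_zero]
    simpa only [norm_inv, Function.comp_def] using tendsto_inv_atTop_zero.comp hF
  have hterm : ∀ i ∈ Finset.range (k + 1), Tendsto (fun t : ℂ =>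
      (k.choose i : ℂ) * iteratedDeriv i φ 0 * (t ^ (k - i) / t ^ k)) F
      (𝓝 (if i = 0 then φ 0 else 0)) := by
    intro i hi
    have hik : i ≤ k := by simpa [Nat.lt_succ_iff] using hi
    have h1 : Tendsto (fun t : ℂ => (k.choose i : ℂ) * iteratedDeriv i φ 0 * t⁻¹ ^ i) F
        (𝓝 ((k.choose i : ℂ) * iteratedDeriv i φ 0 * 0 ^ i)) := (hinv.pow i).const_mul _
    have h2 : (k.choose i : ℂ) * iteratedDeriv i φ 0 * 0 ^ i = if i = 0 then φ 0 else 0 := by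
      by_cases h : i = 0
      · simp [h]
      · simp [h]
    rw [h2] at h1
    refine h1.congr' ?_
    filter_upwards [hF.eventually_gt_atTop 0] with t ht
    have ht0 : t ≠ 0 := norm_pos_iff.1 ht
    congr 1
    rw [pow_sub₀ t ht0 hik, inv_pow]
    field_simp
  have := tendsto_finsetSum _ hterm
  simpa using this

variable {q : ℕ} {b : Fin q → ℂ} {S : Finset (Fin q)} {β : ℂ} {n : Fin q → ℕ}

lemma tendsto_norm_atTop_strip (A : ℝ) :
    Tendsto (fun t : ℂ => ‖t‖) (comap Complex.re atBot ⊓ 𝓟 {t : ℂ | |t.im| ≤ A}) atTop := by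
  have h : Tendsto Complex.re (comap Complex.re atBot ⊓ 𝓟 {t : ℂ | |t.im| ≤ A}) atBot :=
    tendsto_comap.mono_left inf_le_left
  exact tendsto_atTop_mono (fun t => (neg_le_abs _).trans (Complex.abs_re_le_norm t))
    (tendsto_neg_atBot_atTop.comp h)

/-- The terms `m ≥ 1` carry an extra `exp (Re t)`, while the contour of radius `1 / 2` costs only
`exp (‖t‖ / 2)`. In the strip `‖t‖ ≤ -Re t + A`, so a factor `exp (Re t / 2 + A / 2)` remains. -/
lemma tendsto_frobeniusSeries_tail {c : ℕ → ℂ → ℂ} (hc : RapidlyDecaying c) (β : ℂ) (k : ℕ)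
    (A : ℝ) :
    Tendsto (fun t : ℂ => (∑' m, frobeniusTerm β c (m + 1) t) / (Complex.exp (β * t) * t ^ k))
      (comap Complex.re atBot ⊓ 𝓟 {t : ℂ | |t.im| ≤ A}) (𝓝 0) := by
  obtain ⟨-, M, hM, hs⟩ := hc
  have hre : Tendsto Complex.re (comap Complex.re atBot ⊓ 𝓟 {t : ℂ | |t.im| ≤ A}) atBot :=
    tendsto_comap.mono_left inf_le_left
  have hM0 : ∀ m, 0 ≤ M m := fun m => (norm_nonneg _).trans (hM m _ half_mem_sphere)
  have hsum : Summable fun m => M (m + 1) := by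
    have := hs 1 zero_le_one
    simp only [one_pow, mul_one] at this
    exact (summable_nat_add_iff 1).2 this
  have hlim : Tendsto (fun t : ℂ => (∑' m, M (m + 1)) * Real.exp (t.re / 2 + A / 2))
      (comap Complex.re atBot ⊓ 𝓟 {t : ℂ | |t.im| ≤ A}) (𝓝 0) := by
    have h1 : Tendsto (fun t : ℂ => t.re / 2 + A / 2)
        (comap Complex.re atBot ⊓ 𝓟 {t : ℂ | |t.im| ≤ A}) atBot :=
      tendsto_atBot_add_const_right _ _ (hre.atBot_div_const two_pos)
    simpa using (Real.tendsto_exp_atBot.comp h1).const_mul (∑' m, M (m + 1))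
  refine squeeze_zero_norm' ?_ hlim
  filter_upwards [hre.eventually_le_atBot 0, (tendsto_norm_atTop_strip A).eventually_ge_atTop 1,
    mem_inf_of_right (mem_principal_self _)] with t ht0 ht1 htA
  have htA' : |t.im| ≤ A := htA
  have hbound : ∀ m : ℕ, ‖frobeniusTerm β c (m + 1) t‖ ≤
      M (m + 1) * (‖Complex.exp (β * t)‖ * Real.exp (t.re / 2 + A / 2)) := by
    intro m
    refine (norm_frobeniusTerm_le β (hM (m + 1)) t).trans ?_
    refine mul_le_mul_of_nonneg_left ?_ (hM0 _)
    rw [mul_assoc, ← Real.exp_add]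
    refine mul_le_mul_of_nonneg_left (Real.exp_le_exp.2 ?_) (norm_nonneg _)
    have h1 : ‖t‖ ≤ -t.re + A := by
      have := Complex.norm_le_abs_re_add_abs_im t
      rw [abs_of_nonpos ht0] at this
      linarith
    have h2 : ((m + 1 : ℕ) : ℝ) * t.re ≤ t.re := by
      push_cast
      nlinarith [(Nat.cast_nonneg m : (0 : ℝ) ≤ m)]
    linarith
  have hnorm : ‖∑' m, frobeniusTerm β c (m + 1) t‖ ≤
      (∑' m, M (m + 1)) * (‖Complex.exp (β * t)‖ * Real.exp (t.re / 2 + A / 2)) := by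
    rw [← tsum_mul_right]
    exact tsum_of_norm_bounded (hsum.mul_right _).hasSum hbound
  have hpos : 0 < ‖Complex.exp (β * t)‖ := norm_pos_iff.2 (Complex.exp_ne_zero _)
  have hpow : 1 ≤ ‖t‖ ^ k := one_le_pow₀ ht1
  rw [norm_div, norm_mul, norm_pow, div_le_iff₀ (by positivity)]
  refine hnorm.trans ?_
  have h0 : 0 ≤ (∑' m, M (m + 1)) := tsum_nonneg fun m => hM0 _
  calc _ = (∑' m, M (m + 1)) * Real.exp (t.re / 2 + A / 2) * (‖Complex.exp (β * t)‖ * 1) := by ring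
    _ ≤ _ := by gcongr

-- The sine factors give a pole of order `|S|` at `β`, and the reciprocal Gammas a zero whose order
-- is the cardinality in `hk`. The net order is `k + 1`, whence the power `t ^ k`.
open Classical in
lemma tendsto_meijerG (hq : 1 ≤ q) (hS : ∀ s ∈ S, b s = β + n s) (hβ : ∃ s ∈ S, b s = β) {k : ℕ}
    (hk : (Finset.univ.filter fun s => ∃ n : ℕ, 1 - b s + β = -n).card + (k + 1) = S.card) :
    ∃ C : ℂ, C ≠ 0 ∧ ∀ A : ℝ, Tendsto
      (fun t : ℂ => meijerG b S t / (Complex.exp (β * t) * t ^ k))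
      (comap Complex.re atBot ⊓ 𝓟 {t : ℂ | |t.im| ≤ A}) (𝓝 C) := by
  obtain ⟨σ, hσ, hσ0, hσw⟩ := exists_pi_div_sin_factor
  obtain ⟨ψ, hψ, hψ0, h⟩ := exists_recipGammaProd_factor b β
  set N := (Finset.univ.filter fun s => ∃ n : ℕ, 1 - b s + β = -n).card
  have hc := rapidlyDecaying_meijerCoeff hq b β S.card
  have hφ : DifferentiableOn ℂ (fun w => σ w ^ S.card * ψ w) (Metric.ball 0 1) := by
    have := hψ.differentiableOn (s := Metric.ball 0 1)
    fun_prop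
  refine ⟨(-∏ s ∈ S, -(-1) ^ n s) * ((k.factorial : ℂ)⁻¹ * (σ 0 ^ S.card * ψ 0) + 0), ?_,
    fun A => ?_⟩
  · refine mul_ne_zero (sign_ne_zero S n) ?_
    rw [hσ0, add_zero, one_pow, one_mul]
    exact mul_ne_zero (inv_ne_zero (Nat.cast_ne_zero.2 k.factorial_ne_zero)) hψ0
  have h0 : ∀ t, frobeniusTerm β (meijerCoeff b β S.card) 0 t =
      Complex.exp (β * t) * ((2 * Real.pi * Complex.I)⁻¹ * ∮ w in C(0, 1 / 2),
      (w ^ (k + 1))⁻¹ * ((σ w ^ S.card * ψ w) * Complex.exp (w * t))) := by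
    intro t
    rw [frobeniusTerm, mul_left_comm, ← circleIntegral.integral_const_mul (Complex.exp (β * t))]
    congr 1
    refine circleIntegral.integral_congr (by norm_num) fun w hw => ?_
    obtain ⟨hw1, hw0⟩ := sphere_half_prop hw
    simp only [meijerCoeff, Nat.cast_zero, add_zero, zero_mul, pow_zero, one_mul]
    rw [h w, hσw w hw1 hw0, add_mul, Complex.exp_add, mul_pow, inv_pow]
    have e2 : w ^ S.card = w ^ N * w ^ (k + 1) := by rw [← pow_add, hk]
    rw [e2, mul_inv]
    linear_combination ((w ^ (k + 1))⁻¹ * σ w ^ S.card * ψ w * Complex.exp (β * t) *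
      Complex.exp (w * t)) * inv_mul_cancel₀ (pow_ne_zero N hw0)
  have hlim := ((tendsto_inv_mul_circleIntegral hφ k (tendsto_norm_atTop_strip A)).add
    (tendsto_frobeniusSeries_tail hc β k A)).const_mul (-∏ s ∈ S, -(-1 : ℂ) ^ n s)
  refine hlim.congr fun t => ?_
  rw [meijerG_eq_frobeniusSeries hS hβ, frobeniusSeries,
    (hc.summable_norm β t).of_norm.tsum_eq_zero_add, h0]
  have hexp := Complex.exp_ne_zero (β * t)
  rw [mul_div_assoc (-∏ s ∈ S, -(-1 : ℂ) ^ n s), add_div, mul_div_mul_left _ _ hexp]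

end MeijerEuler

end

/-! ### Linear independence from leading terms and monodromy -/

noncomputable section

namespace MeijerEuler

/-- Multiplication by a power is negligible against an exponential, in the comparison of two
leading terms `exp (β s) * s ^ d` as `s → -∞`. -/
lemma tendsto_leading_ratio {β γ : ℂ} {d e : ℕ} (h : γ.re < β.re ∨ γ.re = β.re ∧ d < e) :
    Tendsto (fun s : ℝ => Complex.exp (β * s) * (s : ℂ) ^ d / (Complex.exp (γ * s) * (s : ℂ) ^ e))
      atBot (𝓝 0) := by
  have hn : ∀ s : ℝ, ‖Complex.exp (β * s) * (s : ℂ) ^ d / (Complex.exp (γ * s) * (s : ℂ) ^ e)‖ =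
      Real.exp ((β.re - γ.re) * s) * (|s| ^ d / |s| ^ e) := by
    intro s
    rw [norm_div, norm_mul, norm_mul, norm_pow, norm_pow, Complex.norm_exp, Complex.norm_exp,
      Complex.norm_real, Real.norm_eq_abs, sub_mul, Real.exp_sub]
    simp only [Complex.mul_re, Complex.ofReal_re, Complex.ofReal_im, mul_zero, sub_zero]
    rw [mul_div_mul_comm]
  rw [tendsto_zero_iff_norm_tendsto_zero]
  simp only [hn]
  have habs : Tendsto (fun s : ℝ => |s|) atBot atTop := tendsto_abs_atBot_atTop
  rcases h with h | ⟨h, hde⟩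
  · have hδ : 0 < β.re - γ.re := sub_pos.2 h
    have h1 := (isLittleO_pow_exp_pos_mul_atTop (k := d) hδ).tendsto_div_nhds_zero.comp
      tendsto_neg_atBot_atTop
    refine squeeze_zero_norm' ?_ h1
    filter_upwards [eventually_le_atBot (-1 : ℝ)] with s hs
    have hs' : |s| = -s := abs_of_nonpos (by linarith)
    have h2 : |s| ^ d / |s| ^ e ≤ (-s) ^ d := by
      rw [hs']
      exact div_le_self (pow_nonneg (by linarith) _) (one_le_pow₀ (by linarith))
    rw [Real.norm_of_nonneg (by positivity)]
    calc _ ≤ Real.exp ((β.re - γ.re) * s) * (-s) ^ d := by gcongr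
      _ = _ := by
        simp only [Function.comp]
        rw [mul_neg, Real.exp_neg, div_inv_eq_mul, mul_comm]
  · have h1 : Tendsto (fun s : ℝ => (|s| ^ (e - d))⁻¹) atBot (𝓝 0) :=
      tendsto_inv_atTop_zero.comp ((tendsto_pow_atTop (by omega)).comp habs)
    refine h1.congr' ?_
    filter_upwards [eventually_lt_atBot (0 : ℝ)] with s hs
    have hs0 : |s| ≠ 0 := abs_ne_zero.2 hs.ne
    rw [h, sub_self, zero_mul, Real.exp_zero, one_mul, pow_sub₀ _ hs0 hde.le]
    field_simp

/-- Functions whose leading terms at `-∞` have distinct data `(Re β, d, μ)`, where `μ` is the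
multiplier of the leading coefficient under a shift indexed by `k`, are linearly independent. -/
lemma eq_zero_of_leading_terms {ι : Type*} [Fintype ι] (β μ C : ι → ℂ) (d : ι → ℕ)
    (g : ι → ℕ → ℝ → ℂ) (hC : ∀ j, C j ≠ 0)
    (hg : ∀ j k, Tendsto (fun s : ℝ => g j k s / (Complex.exp (β j * s) * (s : ℂ) ^ d j)) atBot
      (𝓝 (C j * μ j ^ k)))
    (hinj : ∀ i j, (β i).re = (β j).re → d i = d j → μ i = μ j → i = j) (a : ι → ℂ)
    (h : ∀ k s, ∑ j, a j * g j k s = 0) (j : ι) : a j = 0 := by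
  classical
  by_contra hj
  set T := Finset.univ.filter fun j => a j ≠ 0 with hT
  -- As `s → -∞` the smallest real part dominates, and among those the highest power of `s`.
  obtain ⟨j₁, hj₁, hmin⟩ := T.exists_min_image (fun j => (β j).re) ⟨j, by simp [hT, hj]⟩
  obtain ⟨j₀, hj₀, hmax⟩ := (T.filter fun j => (β j).re = (β j₁).re).exists_max_image d
    ⟨j₁, by simp [hj₁]⟩
  rw [Finset.mem_filter] at hj₀
  have ha₀ : a j₀ ≠ 0 := by simpa [hT] using hj₀.1
  set J := (T.filter fun j => (β j).re = (β j₁).re).filter fun j => d j = d j₀ with hJ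
  -- Terms of the same size as `j₀` differ in their multiplier. Applying `p` to the shift kills all
  -- their leading coefficients except that of `j₀`.
  set p : Polynomial ℂ := ∏ i ∈ J.erase j₀, (Polynomial.X - Polynomial.C (μ i)) with hp
  have hp0 : p.eval (μ j₀) ≠ 0 := by
    rw [hp, Polynomial.eval_prod, Finset.prod_ne_zero_iff]
    intro i hi
    rw [Finset.mem_erase, hJ, Finset.mem_filter, Finset.mem_filter] at hi
    simp only [Polynomial.eval_sub, Polynomial.eval_X, Polynomial.eval_C]
    rw [sub_ne_zero]
    exact fun he => hi.1 (hinj i j₀ (hi.2.1.2.trans hj₀.2.symm) hi.2.2 he.symm)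
  have hpJ : ∀ i ∈ J, i ≠ j₀ → p.eval (μ i) = 0 := by
    intro i hi hne
    rw [hp, Polynomial.eval_prod]
    exact Finset.prod_eq_zero (Finset.mem_erase.2 ⟨hne, hi⟩) (by simp)
  set P : ι → ℝ → ℂ := fun j s => ∑ k ∈ Finset.range (p.natDegree + 1), p.coeff k * g j k s with hP
  have hPlim : ∀ j, Tendsto (fun s : ℝ => P j s / (Complex.exp (β j * s) * (s : ℂ) ^ d j)) atBot
      (𝓝 (C j * p.eval (μ j))) := by
    intro j
    rw [Polynomial.eval_eq_sum_range, Finset.mul_sum]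
    simp only [hP, Finset.sum_div]
    refine tendsto_finsetSum _ fun k _ => ?_
    convert (hg j k).const_mul (p.coeff k) using 2 <;> ring
  have hPsum : ∀ s, ∑ j, a j * P j s = 0 := by
    intro s
    simp only [hP, Finset.mul_sum]
    rw [Finset.sum_comm]
    refine Finset.sum_eq_zero fun k _ => ?_
    rw [← mul_zero (p.coeff k), ← h k s, Finset.mul_sum]
    exact Finset.sum_congr rfl fun j _ => by ring
  have hne : ∀ j, ∀ᶠ s : ℝ in atBot, Complex.exp (β j * s) * (s : ℂ) ^ d j ≠ 0 := by
    intro j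
    filter_upwards [eventually_lt_atBot (0 : ℝ)] with s hs
    exact mul_ne_zero (Complex.exp_ne_zero _) (pow_ne_zero _ (by exact_mod_cast hs.ne))
  have hlim : ∀ j ∈ Finset.univ, Tendsto (fun s : ℝ =>
      a j * (P j s / (Complex.exp (β j₀ * s) * (s : ℂ) ^ d j₀))) atBot
      (𝓝 (if j = j₀ then a j₀ * (C j₀ * p.eval (μ j₀)) else 0)) := by
    intro j _
    by_cases hjj : j = j₀
    · subst hjj
      simpa using (hPlim j).const_mul (a j)
    rw [if_neg hjj]
    by_cases haj : a j = 0
    · simp [haj]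
    have hjT : j ∈ T := by simp [hT, haj]
    rw [← mul_zero (a j)]
    refine Tendsto.const_mul _ ?_
    have hfac : (fun s : ℝ => P j s / (Complex.exp (β j * s) * (s : ℂ) ^ d j) *
        (Complex.exp (β j * s) * (s : ℂ) ^ d j / (Complex.exp (β j₀ * s) * (s : ℂ) ^ d j₀)))
        =ᶠ[atBot] fun s : ℝ => P j s / (Complex.exp (β j₀ * s) * (s : ℂ) ^ d j₀) := by
      filter_upwards [hne j] with s hs
      rw [div_mul_div_cancel₀ hs]
    refine Tendsto.congr' hfac ?_
    -- In `J` the normalisations have equal modulus and the leading coefficient is killed by `p`;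
    -- outside `J` the normalisation itself is negligible.
    by_cases hjJ : j ∈ J
    · have h1 := hPlim j
      rw [hpJ j hjJ hjj, mul_zero] at h1
      refine h1.zero_mul_isBoundedUnder_le ?_
      rw [hJ, Finset.mem_filter, Finset.mem_filter] at hjJ
      refine isBoundedUnder_of_eventually_le (a := 1) ?_
      filter_upwards [hne j] with s hs
      have he : ‖Complex.exp (β j * s)‖ = ‖Complex.exp (β j₀ * s)‖ := by
        rw [Complex.norm_exp, Complex.norm_exp]
        simp [hjJ.1.2, hj₀.2]
      simp only [Function.comp]
      rw [norm_div, norm_mul, norm_mul, he, hjJ.2]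
      exact div_self_le_one _
    · have h1 : (β j₀).re < (β j).re ∨ (β j₀).re = (β j).re ∧ d j < d j₀ := by
        rcases (hmin j hjT).lt_or_eq with hlt | heq
        · left; rw [hj₀.2]; exact hlt
        · right
          have hj' : j ∈ T.filter fun j => (β j).re = (β j₁).re :=
            Finset.mem_filter.2 ⟨hjT, heq.symm⟩
          refine ⟨hj₀.2.trans heq, lt_of_le_of_ne (hmax j hj') fun hd => hjJ ?_⟩
          rw [hJ]
          exact Finset.mem_filter.2 ⟨hj', hd⟩
      simpa using (hPlim j).mul (tendsto_leading_ratio h1)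
  have hsum := tendsto_finsetSum _ hlim
  have hzero : (fun s : ℝ => ∑ j, a j * (P j s / (Complex.exp (β j₀ * s) * (s : ℂ) ^ d j₀))) =
      fun _ => 0 := by
    funext s
    simp only [← mul_div_assoc]
    rw [← Finset.sum_div, hPsum, zero_div]
  rw [hzero] at hsum
  simp only [Finset.sum_ite_eq', Finset.mem_univ, if_true] at hsum
  exact mul_ne_zero ha₀ (mul_ne_zero (hC j₀) hp0) (tendsto_nhds_unique hsum tendsto_const_nhds)

/-- Translation by `c` keeps `s + c` in a strip and `(s + c) ^ k ~ s ^ k`, so only the factor `exp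
(β c)` appears. -/
lemma tendsto_shift_leading {G : ℂ → ℂ} {β C : ℂ} {k : ℕ}
    (h : ∀ A : ℝ, Tendsto (fun t : ℂ => G t / (Complex.exp (β * t) * t ^ k))
      (comap Complex.re atBot ⊓ 𝓟 {t : ℂ | |t.im| ≤ A}) (𝓝 C)) (c : ℂ) :
    Tendsto (fun s : ℝ => G (s + c) / (Complex.exp (β * s) * (s : ℂ) ^ k)) atBot
      (𝓝 (C * Complex.exp (β * c))) := by
  have hstrip : Tendsto (fun s : ℝ => (s : ℂ) + c) atBot
      (comap Complex.re atBot ⊓ 𝓟 {t : ℂ | |t.im| ≤ |c.im|}) := by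
    refine tendsto_inf.2 ⟨tendsto_comap_iff.2 ?_, tendsto_principal.2 ?_⟩
    · simpa [Function.comp_def] using tendsto_atBot_add_const_right atBot c.re tendsto_id
    · simp
  have h1 := (h |c.im|).comp hstrip
  have hinv : Tendsto (fun s : ℝ => ((s : ℂ))⁻¹) atBot (𝓝 0) := by
    rw [tendsto_zero_iff_norm_tendsto_zero]
    simpa [Function.comp_def] using tendsto_inv_atTop_zero.comp tendsto_abs_atBot_atTop
  have h2 : Tendsto (fun s : ℝ => (1 + c * (s : ℂ)⁻¹) ^ k) atBot (𝓝 1) := by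
    simpa using (((hinv.const_mul c).const_add 1).pow k)
  have h3 := (h1.mul_const (Complex.exp (β * c))).mul h2
  rw [mul_one] at h3
  refine h3.congr' ?_
  filter_upwards [eventually_lt_atBot (0 : ℝ), eventually_lt_atBot (-c.re)] with s hs hs'
  have hs0 : (s : ℂ) ≠ 0 := by exact_mod_cast hs.ne
  have hsc : (s : ℂ) + c ≠ 0 := by
    intro h0
    have := congrArg Complex.re h0
    simp at this
    linarith
  have e1 : (1 + c * (s : ℂ)⁻¹) = (s + c) / s := by field_simp
  simp only [Function.comp]
  rw [e1, div_pow, mul_add, Complex.exp_add]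
  have := Complex.exp_ne_zero (β * s)
  have := Complex.exp_ne_zero (β * c)
  field_simp

/-- A linear relation between branches on a domain extends to the Riemann surface of the
logarithm. -/
lemma exists_shift_relation {ι : Type*} [Fintype ι] {U : Set ℂ} (hUo : IsOpen U)
    (hUn : U.Nonempty) (hU0 : (0 : ℂ) ∉ U) {L : ι → ℂ → ℂ}
    (hL : ∀ j, ∀ ζ ∈ U, HasDerivAt (L j) ζ⁻¹ ζ) {F : ι → ℂ → ℂ}
    (hF : ∀ j, Differentiable ℂ (F j)) {a : ι → ℂ}
    (h : ∀ ζ ∈ U, ∑ j, a j * F j (L j ζ) = 0) :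
    ∃ c : ι → ℂ, ∀ t, ∑ j, a j * F j (t + c j) = 0 := by
  obtain ⟨ζ₀, hζ₀⟩ := hUn
  have h0 : ζ₀ ≠ 0 := fun h => hU0 (h ▸ hζ₀)
  set t₀ := Complex.log ζ₀
  have ht₀ : Complex.exp t₀ = ζ₀ := Complex.exp_log h0
  have hV : IsOpen (Complex.exp ⁻¹' U) := hUo.preimage Complex.continuous_exp
  obtain ⟨r, hr, hball⟩ := Metric.isOpen_iff.1 hV t₀ (by rwa [Set.mem_preimage, ht₀])
  -- Each branch satisfies `L j (exp t) = t + c j` near `t₀`; the identity theorem for entire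
  -- functions then does the rest.
  have hconst : ∀ j, ∀ t ∈ Metric.ball t₀ r, L j (Complex.exp t) - t = L j ζ₀ - t₀ := by
    intro j t ht
    have hd : ∀ t ∈ Metric.ball t₀ r, HasDerivAt (fun t => L j (Complex.exp t) - t) 0 t := by
      intro t ht
      have := ((hL j _ (hball ht)).comp t (Complex.hasDerivAt_exp t)).sub (hasDerivAt_id t)
      rw [inv_mul_cancel₀ (Complex.exp_ne_zero t), sub_self] at this
      exact this
    have := Metric.isOpen_ball.is_const_of_deriv_eq_zero (convex_ball t₀ r).isPreconnected
      (fun t ht => (hd t ht).differentiableAt.differentiableWithinAt)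
      (fun t ht => (hd t ht).deriv) ht (Metric.mem_ball_self hr)
    rw [this, ht₀]
  refine ⟨fun j => L j ζ₀ - t₀, fun t => ?_⟩
  set f : ℂ → ℂ := fun t => ∑ j, a j * F j (t + (L j ζ₀ - t₀))
  have hf : Differentiable ℂ f := by
    refine Differentiable.fun_sum fun j _ => Differentiable.const_mul ?_ _
    exact (hF j).comp (by fun_prop : Differentiable ℂ fun t => t + (L j ζ₀ - t₀))
  have hf0 : f = 0 := by
    refine AnalyticOnNhd.eq_of_eventuallyEq (z₀ := t₀) (fun z _ => hf.analyticAt z)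
      (fun z _ => analyticAt_const) ?_
    filter_upwards [Metric.ball_mem_nhds t₀ hr] with t ht
    rw [Pi.zero_apply, ← h _ (hball ht)]
    refine Finset.sum_congr rfl fun j _ => ?_
    rw [← hconst j t ht]
    ring_nf
  exact congrFun hf0 t

end MeijerEuler

end

/-! ### Dimension of the solution space -/

noncomputable section

namespace MeijerEuler

lemma analyticAt_eulerFactor {x : ℂ} {f : ℂ → ℂ} (hf : AnalyticAt ℂ f x) (c : ℂ) :
    AnalyticAt ℂ (eulerFactor c f) x :=
  (analyticAt_id.mul hf.deriv).sub (analyticAt_const.mul hf)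

/-- Since `ζ` is invertible at `x ≠ 0`, the summand `ζ f'` has order exactly one less than `f` and
dominates `c f`. -/
lemma analyticOrderAt_eulerFactor {x : ℂ} (hx : x ≠ 0) {f : ℂ → ℂ} (hf : AnalyticAt ℂ f x)
    (c : ℂ) {n : ℕ} (hn : analyticOrderAt f x = (n + 1 : ℕ)) :
    analyticOrderAt (eulerFactor c f) x = n := by
  have hfx : f x = 0 := apply_eq_zero_of_analyticOrderAt_ne_zero (by rw [hn]; simp)
  have hd : analyticOrderAt (deriv f) x = n := by
    have := hf.analyticOrderAt_deriv_add_one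
    simp only [hfx, sub_zero] at this
    rw [show (fun y => f y) = f from rfl, hn, Nat.cast_add, Nat.cast_one] at this
    exact ENat.add_left_injective_of_ne_top (by simp) this
  have h1 : analyticOrderAt (id * deriv f) x = n := by
    rw [analyticOrderAt_mul analyticAt_id hf.deriv, hd,
      analyticAt_id.analyticOrderAt_eq_zero.2 (by simpa using hx), zero_add]
  have h2 : (n : ℕ∞) < analyticOrderAt ((fun _ => -c) * f) x := by
    rw [analyticOrderAt_mul analyticAt_const hf, hn]
    refine lt_of_lt_of_le ?_ le_add_self
    exact_mod_cast Nat.lt_succ_self n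
  have h3 : eulerFactor c f = id * deriv f + (fun _ => -c) * f := by
    funext y
    simp [eulerFactor, sub_eq_add_neg]
  rw [h3, analyticOrderAt_add_eq_left_of_lt (by rw [h1]; exact h2), h1]

lemma analyticOrderAt_foldr_eulerFactor {x : ℂ} (hx : x ≠ 0) {f : ℂ → ℂ} (hf : AnalyticAt ℂ f x)
    (l : List ℂ) (n : ℕ) (hn : analyticOrderAt f x = (n + l.length : ℕ)) :
    AnalyticAt ℂ (l.foldr eulerFactor f) x ∧ analyticOrderAt (l.foldr eulerFactor f) x = n := by
  induction l generalizing n with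
  | nil => exact ⟨hf, by simpa using hn⟩
  | cons a l ih =>
    obtain ⟨h1, h2⟩ := ih (n + 1) (by rw [hn, List.length_cons]; congr 1; omega)
    exact ⟨analyticAt_eulerFactor h1 a, analyticOrderAt_eulerFactor hx h1 a h2⟩

variable {q : ℕ} {b : Fin q → ℂ} {U : Set ℂ}

/-- Uniqueness for the initial value problem. -/
lemma IsSolution.eq_zero (hq : 1 ≤ q) (hUo : IsOpen U) (hUc : IsPreconnected U)
    {u : ℂ → ℂ} (hu : IsSolution b U u) {x : ℂ} (hxU : x ∈ U) (hx : x ≠ 0)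
    (h0 : ∀ k < q, iteratedDeriv k u x = 0) : ∀ ζ ∈ U, u ζ = 0 := by
  have han : AnalyticOnNhd ℂ u U := hu.1.analyticOnNhd hUo
  have hux := han x hxU
  have hle : (q : ℕ∞) ≤ analyticOrderAt u x :=
    (natCast_le_analyticOrderAt_iff_iteratedDeriv_eq_zero hux).2 h0
  have htop : analyticOrderAt u x = ⊤ := by
    by_contra hne
    obtain ⟨N, hN⟩ := ENat.ne_top_iff_exists.1 hne
    rw [← hN] at hle
    have hqN : q ≤ N := by exact_mod_cast hle
    -- If `u` vanished to finite order `N ≥ q`, the product of Euler factors would lower it to `N -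
    -- q`, whereas `ζ u` still has order `N`; this contradicts `q ≥ 1`.
    have h1 := (analyticOrderAt_foldr_eulerFactor hx hux (List.ofFn b) (N - q)
      (by rw [← hN, List.length_ofFn, Nat.sub_add_cancel hqN])).2
    have h2 : (List.ofFn b).foldr eulerFactor u =ᶠ[𝓝 x] id * u := by
      filter_upwards [hUo.mem_nhds hxU] with ζ hζ
      exact sub_eq_zero.1 (hu.2 ζ hζ)
    rw [analyticOrderAt_congr h2, analyticOrderAt_mul analyticAt_id hux, ← hN,
      analyticAt_id.analyticOrderAt_eq_zero.2 (by simpa using hx), zero_add] at h1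
    have : N = N - q := by exact_mod_cast h1
    omega
  exact han.eqOn_of_preconnected_of_eventuallyEq (fun _ _ => analyticAt_const) hUc hxU
    (analyticOrderAt_eq_top.1 htop)

lemma DifferentiableOn.eulerFactor (hUo : IsOpen U) {u : ℂ → ℂ} (hu : DifferentiableOn ℂ u U)
    (c : ℂ) : DifferentiableOn ℂ (eulerFactor c u) U :=
  (differentiableOn_id.mul (hu.deriv hUo)).sub (hu.const_mul c)

lemma DifferentiableOn.foldr_eulerFactor (hUo : IsOpen U) {u : ℂ → ℂ}
    (hu : DifferentiableOn ℂ u U) (l : List ℂ) :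
    DifferentiableOn ℂ (l.foldr MeijerEuler.eulerFactor u) U := by
  induction l with
  | nil => exact hu
  | cons a l ih => exact DifferentiableOn.eulerFactor hUo ih a

lemma foldr_eulerFactor_add_mul (hUo : IsOpen U) {u v : ℂ → ℂ} (hu : DifferentiableOn ℂ u U)
    (hv : DifferentiableOn ℂ v U) (a : ℂ) (l : List ℂ) :
    ∀ ζ ∈ U, l.foldr eulerFactor (fun ζ => u ζ + a * v ζ) ζ =
      l.foldr eulerFactor u ζ + a * l.foldr eulerFactor v ζ := by
  induction l with
  | nil => exact fun _ _ => rfl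
  | cons x l ih =>
    intro ζ hζ
    have hnhds := hUo.mem_nhds hζ
    have hu' := ((DifferentiableOn.foldr_eulerFactor hUo hu l).differentiableAt hnhds).hasDerivAt
    have hv' := ((DifferentiableOn.foldr_eulerFactor hUo hv l).differentiableAt hnhds).hasDerivAt
    have hd := (hu'.add (hv'.const_mul a)).congr_of_eventuallyEq
      (f₁ := l.foldr eulerFactor (fun ζ => u ζ + a * v ζ))
      (by filter_upwards [hnhds] with y hy using ih y hy)
    simp only [List.foldr_cons, eulerFactor]
    rw [hd.deriv, ih ζ hζ]
    ring

lemma IsSolution.add_mul (hUo : IsOpen U) {u v : ℂ → ℂ} (hu : IsSolution b U u)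
    (hv : IsSolution b U v) (a : ℂ) : IsSolution b U fun ζ => u ζ + a * v ζ := by
  refine ⟨hu.1.add (hv.1.const_mul a), fun ζ hζ => ?_⟩
  have h1 := hu.2 ζ hζ
  have h2 := hv.2 ζ hζ
  rw [eulerProd] at h1 h2 ⊢
  rw [foldr_eulerFactor_add_mul hUo hu.1 hv.1 a _ ζ hζ]
  linear_combination h1 + a * h2

lemma IsSolution.add_sum_mul (hUo : IsOpen U) {ι : Type*} {u : ℂ → ℂ} (hu : IsSolution b U u)
    {y : ι → ℂ → ℂ} (hy : ∀ j, IsSolution b U (y j)) (a : ι → ℂ) (s : Finset ι) :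
    IsSolution b U fun ζ => u ζ + ∑ j ∈ s, a j * y j ζ := by
  classical
  induction s using Finset.induction_on with
  | empty => simpa using hu
  | insert i s hi ih =>
    convert ih.add_mul hUo (hy i) (a i) using 2 with ζ
    rw [Finset.sum_insert hi]
    ring

lemma isSolution_zero (b : Fin q → ℂ) (U : Set ℂ) : IsSolution b U fun _ => 0 := by
  refine ⟨differentiableOn_const _, fun ζ _ => ?_⟩
  have h : ∀ l : List ℂ, l.foldr eulerFactor (fun _ => 0) = fun _ => 0 := by
    intro l
    induction l with
    | nil => rfl
    | cons a l ih => rw [List.foldr_cons, ih]; funext ζ; simp [eulerFactor]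
  simp [eulerProd, h]

lemma iteratedDeriv_add_sum_mul {ι : Type*} {x : ℂ} {u : ℂ → ℂ} (hu : AnalyticAt ℂ u x)
    {y : ι → ℂ → ℂ} (hy : ∀ j, AnalyticAt ℂ (y j) x) (a : ι → ℂ) (s : Finset ι) (k : ℕ) :
    iteratedDeriv k (fun ζ => u ζ + ∑ j ∈ s, a j * y j ζ) x =
      iteratedDeriv k u x + ∑ j ∈ s, a j * iteratedDeriv k (y j) x := by
  have h : ∀ j ∈ s, ContDiffAt ℂ k (fun ζ => a j * y j ζ) x := fun j _ =>
    (analyticAt_const.mul (hy j)).contDiffAt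
  rw [iteratedDeriv_fun_add hu.contDiffAt (ContDiffAt.sum h), iteratedDeriv_fun_sum h]
  congr 1
  exact Finset.sum_congr rfl fun j _ => iteratedDeriv_const_mul_field (a j) (y j)

/-- `q` linearly independent solutions form a fundamental system. -/
lemma isFundamentalSystem_of_linearIndependent (hq : 1 ≤ q) (hUo : IsOpen U)
    (hUc : IsConnected U) (hU0 : (0 : ℂ) ∉ U) {y : Fin q → ℂ → ℂ}
    (hy : ∀ j, IsSolution b U (y j))
    (hind : ∀ a : Fin q → ℂ, (∀ ζ ∈ U, ∑ j, a j * y j ζ = 0) → ∀ j, a j = 0) :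
    IsFundamentalSystem b U y := by
  refine ⟨hy, ?_, fun u hu => ?_⟩
  · rw [Fintype.linearIndependent_iff]
    intro a ha
    refine hind a fun ζ hζ => ?_
    simpa using congrFun ha ⟨ζ, hζ⟩
  obtain ⟨x, hxU⟩ := hUc.nonempty
  have hx : x ≠ 0 := fun h => hU0 (h ▸ hxU)
  have hya : ∀ j, AnalyticAt ℂ (y j) x := fun j => (hy j).1.analyticOnNhd hUo x hxU
  have hua : AnalyticAt ℂ u x := hu.1.analyticOnNhd hUo x hxU
  set v : Fin q → Fin q → ℂ := fun j k => iteratedDeriv k (y j) x with hv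
  have hli : LinearIndependent ℂ v := by
    rw [Fintype.linearIndependent_iff]
    intro a ha
    refine hind a fun ζ hζ => ?_
    have h := ((isSolution_zero b U).add_sum_mul hUo hy a Finset.univ).eq_zero hq hUo
      hUc.isPreconnected hxU hx ?_ ζ hζ
    · simpa using h
    · intro k hk
      rw [iteratedDeriv_add_sum_mul analyticAt_const hya]
      have := congrFun ha ⟨k, hk⟩
      simp only [hv, Finset.sum_apply, Pi.smul_apply, smul_eq_mul, Pi.zero_apply] at this
      rw [this]
      simp
  -- The vectors of derivatives of orders below `q` at `x` are `q` independent vectors in `ℂ ^ q`,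
  -- so some combination matches the derivatives of `u`.
  have hspan := hli.span_eq_top_of_card_eq_finrank' (by simp)
  have hmem : (fun k : Fin q => iteratedDeriv k u x) ∈ Submodule.span ℂ (Set.range v) := by
    rw [hspan]; trivial
  obtain ⟨a, ha⟩ := (Submodule.mem_span_range_iff_exists_fun ℂ).1 hmem
  refine ⟨a, fun ζ hζ => ?_⟩
  have h := (hu.add_sum_mul hUo hy (fun j => -a j) Finset.univ).eq_zero hq hUo
      hUc.isPreconnected hxU hx ?_ ζ hζ
  · simp only [neg_mul, Finset.sum_neg_distrib] at h
    linear_combination h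
  · intro k hk
    rw [iteratedDeriv_add_sum_mul hua hya]
    have := congrFun ha ⟨k, hk⟩
    simp only [hv, Finset.sum_apply, Pi.smul_apply, smul_eq_mul] at this
    rw [← this]
    simp

end MeijerEuler

end

/-! ### Blocks of parameters and their multiplicities -/

noncomputable section

namespace MeijerEuler

variable {q : ℕ} {b : Fin q → ℂ} {c : Composition q}

lemma self_mem_upTo (c : Composition q) (j : Fin q) : j ∈ upTo c j := by simp [upTo]

lemma card_upTo (c : Composition q) (j : Fin q) : (upTo c j).card = pos c j := by
  have h : upTo c j = (Finset.Iic (c.invEmbedding j)).map (c.embedding (c.index j)).toEmbedding := by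
    ext i
    simp only [upTo, Finset.mem_filter, Finset.mem_univ, true_and, Finset.mem_map, Finset.mem_Iic,
      RelEmbedding.coe_toEmbedding]
    constructor
    · rintro ⟨h1, h2⟩
      obtain ⟨k, hk⟩ := c.mem_range_embedding_iff'.2 h1.symm
      refine ⟨k, ?_, hk⟩
      rw [← (c.embedding (c.index j)).le_iff_le, hk, c.embedding_comp_inv]
      exact h2
    · rintro ⟨k, hk, rfl⟩
      refine ⟨c.index_embedding _ _, ?_⟩
      conv_rhs => rw [← c.embedding_comp_inv j]
      exact (c.embedding (c.index j)).le_iff_le.2 hk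
  rw [h, Finset.card_map, Fin.card_Iic, pos]

lemma mem_upTo_iff {i j : Fin q} : i ∈ upTo c j ↔ c.index i = c.index j ∧ i ≤ j := by
  simp [upTo]

lemma exists_nat_of_mem_upTo (hclass : ∀ i j, c.index i = c.index j ↔ ∃ k : ℤ, b i - b j = k)
    (hre : ∀ i j, c.index i = c.index j → i ≤ j → (b j).re ≤ (b i).re) {i j : Fin q}
    (hi : i ∈ upTo c j) : ∃ n : ℕ, b i = b j + n := by
  obtain ⟨h1, h2⟩ := mem_upTo_iff.1 hi
  obtain ⟨k, hk⟩ := (hclass i j).1 h1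
  have h3 := hre i j h1 h2
  have h4 : (b i).re - (b j).re = k := by simpa using congrArg Complex.re hk
  have h5 : 0 ≤ k := by
    have : (0 : ℝ) ≤ k := by linarith
    exact_mod_cast this
  obtain ⟨n, rfl⟩ := Int.eq_ofNat_of_zero_le h5
  exact ⟨n, by push_cast at hk; linear_combination hk⟩

-- The reciprocal Gamma for `s` vanishes at `b j` exactly when `b s - b j` is a positive integer.
-- Such an `s` lies in the block of `j`, and before `j` by the ordering of real parts.
open Classical in
lemma filter_pole_eq (hclass : ∀ i j, c.index i = c.index j ↔ ∃ k : ℤ, b i - b j = k)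
    (hre : ∀ i j, c.index i = c.index j → i ≤ j → (b j).re ≤ (b i).re) (j : Fin q) :
    (Finset.univ.filter fun s => ∃ n : ℕ, 1 - b s + b j = -n) =
      (upTo c j).filter fun s => ¬ b s = b j := by
  ext s
  simp only [Finset.mem_filter, Finset.mem_univ, true_and]
  constructor
  · rintro ⟨n, hn⟩
    have hd : b s - b j = ((n + 1 : ℕ) : ℤ) := by push_cast; linear_combination -hn
    have hidx : c.index s = c.index j := (hclass s j).2 ⟨_, hd⟩
    have hr : (b s).re - (b j).re = n + 1 := by
      simpa using congrArg Complex.re hd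
    have hn0 : (0 : ℝ) ≤ n := Nat.cast_nonneg n
    refine ⟨mem_upTo_iff.2 ⟨hidx, ?_⟩, fun he => ?_⟩
    · by_contra hlt
      have := hre j s hidx.symm (not_le.1 hlt).le
      linarith
    · rw [he] at hr
      linarith
  · rintro ⟨hs, hne⟩
    obtain ⟨n, hn⟩ := exists_nat_of_mem_upTo hclass hre hs
    cases n with
    | zero => exact absurd (by simpa using hn) hne
    | succ n => exact ⟨n, by rw [hn]; push_cast; ring⟩

open Classical in
lemma mult_eq_card (c : Composition q) (b : Fin q → ℂ) (j : Fin q) :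
    mult c b j = ((upTo c j).filter fun s => b s = b j).card := by
  exact Nat.subtype_card _ (by simp)

lemma mult_pos (c : Composition q) (b : Fin q → ℂ) (j : Fin q) : 0 < mult c b j := by
  classical
  rw [mult_eq_card, Finset.card_pos]
  exact ⟨j, by simp [self_mem_upTo]⟩

lemma mult_lt_mult {i j : Fin q} (hidx : c.index i = c.index j) (hij : i < j) (hb : b i = b j) :
    mult c b i < mult c b j := by
  classical
  rw [mult_eq_card, mult_eq_card]
  refine Finset.card_lt_card (Finset.ssubset_iff_of_subset ?_ |>.2 ⟨j, ?_, ?_⟩)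
  · intro s hs
    simp only [Finset.mem_filter, mem_upTo_iff] at hs ⊢
    exact ⟨⟨hs.1.1.trans hidx, hs.1.2.trans hij.le⟩, hs.2.trans hb⟩
  · simp [self_mem_upTo]
  · simp [mem_upTo_iff, hij]

/-- Equal multipliers force congruence mod `ℤ`, equal real parts then force `b i = b j`, and equal
parameters in one block are told apart by `mult`, which strictly increases along them. -/
lemma eq_of_leading_data_eq (hclass : ∀ i j, c.index i = c.index j ↔ ∃ k : ℤ, b i - b j = k)
    {i j : Fin q} (hre : (b i).re = (b j).re) (hm : mult c b i - 1 = mult c b j - 1)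
    (he : Complex.exp (b i * (2 * Real.pi * Complex.I)) =
      Complex.exp (b j * (2 * Real.pi * Complex.I))) : i = j := by
  obtain ⟨k, hk⟩ := Complex.exp_eq_exp_iff_exists_int.1 he
  have hbk : b i - b j = k :=
    mul_right_cancel₀ Complex.two_pi_I_ne_zero (by linear_combination hk)
  have hidx : c.index i = c.index j := (hclass i j).2 ⟨k, hbk⟩
  have hk0 : (k : ℝ) = 0 := by
    have : (b i).re - (b j).re = k := by simpa using congrArg Complex.re hbk
    linarith
  have hk0' : k = 0 := by exact_mod_cast hk0
  have hb : b i = b j := by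
    rw [hk0', Int.cast_zero] at hbk
    exact sub_eq_zero.1 hbk
  have hi := mult_pos c b i
  have hj := mult_pos c b j
  rcases lt_trichotomy i j with h | h | h
  · have := mult_lt_mult hidx h hb
    omega
  · exact h
  · have := mult_lt_mult hidx.symm h hb.symm
    omega

lemma exists_tendsto_meijerG_upTo (hq : 1 ≤ q)
    (hclass : ∀ i j, c.index i = c.index j ↔ ∃ k : ℤ, b i - b j = k)
    (hre : ∀ i j, c.index i = c.index j → i ≤ j → (b j).re ≤ (b i).re) (j : Fin q) :
    ∃ C : ℂ, C ≠ 0 ∧ ∀ A : ℝ, Tendsto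
      (fun t : ℂ => meijerG b (upTo c j) t / (Complex.exp (b j * t) * t ^ (mult c b j - 1)))
      (comap Complex.re atBot ⊓ 𝓟 {t : ℂ | |t.im| ≤ A}) (𝓝 C) := by
  classical
  choose! n hn using fun i (hi : i ∈ upTo c j) => exists_nat_of_mem_upTo hclass hre hi
  refine tendsto_meijerG hq hn ⟨j, self_mem_upTo c j, rfl⟩ ?_
  rw [filter_pole_eq hclass hre, Nat.sub_add_cancel (mult_pos c b j), mult_eq_card, add_comm]
  exact Finset.card_filter_add_card_filter_not _

lemma linearIndependent_meijerG (hq : 1 ≤ q)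
    (hclass : ∀ i j, c.index i = c.index j ↔ ∃ k : ℤ, b i - b j = k)
    (hre : ∀ i j, c.index i = c.index j → i ≤ j → (b j).re ≤ (b i).re)
    {U : Set ℂ} (hUo : IsOpen U) (hUn : U.Nonempty) (hU0 : (0 : ℂ) ∉ U)
    {L : Fin q → ℂ → ℂ} (hL : ∀ j, ∀ ζ ∈ U, HasDerivAt (L j) ζ⁻¹ ζ) (a : Fin q → ℂ)
    (h : ∀ ζ ∈ U, ∑ j, a j * meijerG b (upTo c j) (L j ζ) = 0) (j : Fin q) : a j = 0 := by
  have hF : ∀ j, Differentiable ℂ (meijerG b (upTo c j)) := by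
    intro j
    choose! n hn using fun i (hi : i ∈ upTo c j) => exists_nat_of_mem_upTo hclass hre hi
    exact differentiable_meijerG hq hn ⟨j, self_mem_upTo c j, rfl⟩
  obtain ⟨s, hs⟩ := exists_shift_relation hUo hUn hU0 hL hF h
  choose C hC hlim using exists_tendsto_meijerG_upTo hq hclass hre
  refine eq_zero_of_leading_terms b (fun j => Complex.exp (b j * (2 * Real.pi * Complex.I)))
    (fun j => C j * Complex.exp (b j * s j)) (fun j => mult c b j - 1)
    -- Shifting by `2πik` preserves the relation but multiplies the leading coefficient by `exp (2πi
    -- b j) ^ k`.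
    (fun j k x => meijerG b (upTo c j) (x + (s j + k * (2 * Real.pi * Complex.I))))
    (fun j => mul_ne_zero (hC j) (Complex.exp_ne_zero _)) (fun j k => ?_)
    (fun i j h1 h2 h3 => eq_of_leading_data_eq hclass h1 h2 h3) a (fun k x => ?_) j
  · have := tendsto_shift_leading (hlim j) (s j + k * (2 * Real.pi * Complex.I))
    have e : Complex.exp (b j * (s j + k * (2 * Real.pi * Complex.I))) =
        Complex.exp (b j * s j) * Complex.exp (b j * (2 * Real.pi * Complex.I)) ^ k := by
      rw [← Complex.exp_nat_mul, ← Complex.exp_add]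
      ring_nf
    rwa [e, ← mul_assoc (C j)] at this
  · rw [← hs (x + k * (2 * Real.pi * Complex.I))]
    exact Finset.sum_congr rfl fun j _ => by ring_nf

end MeijerEuler

end

/-! ### Assembly of the four assertions -/

theorem theorem3p1 {q : ℕ} (hq : 1 ≤ q) (b : Fin q → ℂ)
    -- the blocks of `c` are the congruence classes mod `ℤ`, each ordered by decreasing real part
    (c : Composition q)
    (hclass : ∀ i j, c.index i = c.index j ↔ ∃ k : ℤ, b i - b j = k)
    (hre : ∀ i j, c.index i = c.index j → i ≤ j → (b j).re ≤ (b i).re)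
    -- a domain in `ℂ \ {0}` with branches `L j` of `log ((-1) ^ ℓ * ζ)`, `ℓ` the position of `j`
    (U : Set ℂ) (hUo : IsOpen U) (hUc : IsConnected U) (hU0 : (0 : ℂ) ∉ U)
    (L : Fin q → ℂ → ℂ) (hLc : ∀ j, ContinuousOn (L j) U)
    (hL : ∀ j, ∀ ζ ∈ U, Complex.exp (L j ζ) = (-1) ^ MeijerEuler.pos c j * ζ) :
    -- the sums of residues converge absolutely
    (∀ (j : Fin q) (t : ℂ),
      Summable fun ω : MeijerEuler.meijerPoles b (MeijerEuler.upTo c j) =>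
        ‖MeijerEuler.residue
          (MeijerEuler.meijerIntegrand b (MeijerEuler.upTo c j) t) (ω : ℂ)‖) ∧
    -- fundamental system
    MeijerEuler.IsFundamentalSystem b U
      (fun j ζ => MeijerEuler.meijerG b (MeijerEuler.upTo c j) (L j ζ)) ∧
    -- the first solution of each class
    (∀ j, MeijerEuler.pos c j = 1 → ∀ ζ ∈ U,
      MeijerEuler.meijerG b (MeijerEuler.upTo c j) (L j ζ) =
        Complex.exp (b j * L j ζ) / (∏ i, Complex.Gamma (1 + b j - b i)) *
          MeijerEuler.hypergeometricZeroF (fun i : {i // i ≠ j} => 1 + b j - b i) ζ) ∧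
    -- leading asymptotics, with logarithms, at the origin
    (∀ j, ∃ C : ℂ, C ≠ 0 ∧ ∀ A : ℝ,
      Tendsto
        (fun t : ℂ => MeijerEuler.meijerG b (MeijerEuler.upTo c j) t /
          (Complex.exp (b j * t) * t ^ (MeijerEuler.mult c b j - 1)))
        (comap Complex.re atBot ⊓ 𝓟 {t : ℂ | |t.im| ≤ A}) (𝓝 C)) := by
  open MeijerEuler in
  classical
  have hn : ∀ j, ∃ n : Fin q → ℕ, ∀ i ∈ upTo c j, b i = b j + n i := by
    intro j
    choose! n hn using fun i (hi : i ∈ upTo c j) => exists_nat_of_mem_upTo hclass hre hi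
    exact ⟨n, hn⟩
  choose n hn using hn
  have hself : ∀ j, ∃ i ∈ upTo c j, b i = b j := fun j => ⟨j, self_mem_upTo c j, rfl⟩
  have hLd : ∀ j, ∀ ζ ∈ U, HasDerivAt (L j) ζ⁻¹ ζ := fun j ζ hζ =>
    hasDerivAt_log_branch hUo (hLc j) (by simp) (hL j) hζ
  refine ⟨fun j t => summable_norm_residue hq (hn j) (hself j) t, ?_, fun j hj ζ hζ => ?_,
    exists_tendsto_meijerG_upTo hq hclass hre⟩
  · exact isFundamentalSystem_of_linearIndependent hq hUo hUc hU0
      (fun j => isSolution_meijerG hq (hn j) (hself j) hUo hU0 (hLc j)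
        (by rw [card_upTo]; exact hL j))
      (linearIndependent_meijerG hq hclass hre hUo hUc.nonempty hU0 hLd)
  · have hup : upTo c j = {j} := by
      obtain ⟨i, hi⟩ := Finset.card_eq_one.1 ((card_upTo c j).trans hj)
      have := self_mem_upTo c j
      rw [hi, Finset.mem_singleton] at this
      rw [hi, this]
    rw [hup]
    refine meijerG_singleton j (fun i k hk => ?_) (by rw [hL j ζ hζ, hj]; ring)
    -- A vanishing `1 / Γ(1 + b j - b i)` would put some `i` with `b i ≠ b j` into `upTo c j = {j}`.
    have hi : i ∈ (upTo c j).filter fun s => ¬ b s = b j := by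
      rw [← filter_pole_eq hclass hre, Finset.mem_filter]
      exact ⟨Finset.mem_univ _, k, by rw [← hk]; ring⟩
    rw [hup, Finset.mem_filter, Finset.mem_singleton] at hi
    exact hi.2 (by rw [hi.1])
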